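/- **Model.** Let $M$ groups of spins be given, of sizes $N_1,\dots,N_M$ with $N=\sum_\nu N_\nu$, where $N_\nu\to\infty$ and $N_\nu/N\to\alpha_\nu$ for every $\nu$. For a real matrix $J=(J_{\lambda\mu})$ let the spins $X_{\nu i}\in\{-1,1\}$ ($1\le\nu\le M$, $1\le i\le N_\nu$) have the joint law $$\mathbb P(X=x)=Z^{-1}\exp\Big(\frac1{2N}\sum_{\lambda,\mu=1}^M J_{\lambda\mu}\sum_{i=1}^{N_\lambda}\sum_{j=1}^{N_\mu}x_{\lambda i}x_{\mu j}\Big),$$ and put $S_\nu=\sum_{i=1}^{N_\nu} X_{\nu i}$. Write $\boldsymbol\alpha=\mathrm{diag}(\alpha_\lambda)$ and $\sqrt{\boldsymbol\alpha}=\mathrm{diag}(\sqrt{\alpha_\lambda})$. For a positive definite (symmetric) matrix $J$ put $$F(y)=\tfrac12 y^TJ^{-1}y-\sum_\lambda\alpha_\lambda\ln\cosh y_\lambda\quad(y\in\mathbb R^M),\qquad \tilde F(t)=F(\operatorname{artanh}t)-F(\operatorname{artanh}m^*)\quad(t\in(-1,1)^M),$$ where $\operatorname{artanh}$ and $\tanh$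 act coordinatewise, and for $\beta>0$ put $$F_\beta(y)=\frac{y^2}{2\beta}-\ln\cosh y\quad(y\in\mathbb R),\qquad \tilde F_\beta(t)=F_\beta(\operatorname{artanh} t)-F_\beta(\operatorname{artanh}m)\quad(t\in(-1,1)).$$ **Theorem.** Assume one of the following. 1. (Homogeneous coupling, low temperature.) $J_{\lambda\mu}=\beta$ for all $\lambda,\mu$, with $\beta>1$. Then $F_\beta$ has exactly two global minimisers $\pm x$, with $x>0$, and $m=\tanh x$ is the largest solution of $\tanh(\beta u)=u$. Put $m^*=(m,\dots,m)$, and let $\Sigma$ be the $M\times M$ matrix all of whose entries are $1/\tilde F_\beta''(m)$, where $\tilde F_\beta''(m)=\tilde F_\beta''(-m)>0$. 2. (Heterogeneous coupling, two groups, low temperature.) $M=2$, $J$ is positive definite with all entries positive, $J^{-1}-\boldsymbol\alpha$ is not positive semidefinite, and $\sqrt N\,(N_\nu/N-\alpha_\nu)\to0$ for each $\nu$. Then $F$ has exactly two global minimisers $\pm x^*$, with $x^*\in(0,\infty)^2$. Put $m^*=\tanh x^*$. 3. (Heterogeneous coupling, any number of groups.) $J$ is positive definite, $F$ has exactly two global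 minimisers $\pm x^*$, with $x^*\in(0,\infty)^M$, $\sqrt N\,(N_\nu/N-\alpha_\nu)\to0$ for each $\nu$, and, with $m^*=\tanh x^*$, the Hessian matrix of $\tilde F$ at $m^*$ is non-singular. In cases 2 and 3 the Hessian matrix $\tilde H$ of $\tilde F$ is the same at $m^*$ and at $-m^*$ and is positive definite; put $\Sigma=\tilde H^{-1}$. In all three cases let $$E=\mathrm{diag}\big(1-(m^*_\lambda)^2\big)+\sqrt{\boldsymbol\alpha}\,\Sigma\,\sqrt{\boldsymbol\alpha}.$$ Then $E$ is positive semidefinite. Conditionally on $S_\nu>0$ for all $\nu$, $$\Big(\frac1{\sqrt{N_\nu}}\sum_{i=1}^{N_\nu}(X_{\nu i}-m^*_\nu)\Big)_{\nu=1,\dots,M}\Longrightarrow\mathcal N(0,E),$$ and conditionally on $S_\nu<0$ for all $\nu$, $$\Big(\frac1{\sqrt{N_\nu}}\sum_{i=1}^{N_\nu}(X_{\nu i}+m^*_\nu)\Big)_{\nu=1,\dots,M}\Longrightarrow\mathcal N(0,E).$$ -/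

import Mathlib

open MeasureTheory ProbabilityTheory Filter Topology

noncomputable section

namespace CurieWeiss

variable {M : ℕ}

/-- Spin configurations of `M` groups, group `ν` having `N ν` spins with values in `{-1, 1}`. -/
def Config (N : Fin M → ℕ) : Type := (ν : Fin M) → Fin (N ν) → ℤˣ

instance (N : Fin M → ℕ) : Fintype (Config N) :=
  inferInstanceAs (Fintype ((ν : Fin M) → Fin (N ν) → ℤˣ))

instance (N : Fin M → ℕ) : MeasurableSpace (Config N) := ⊤

/-- The spin `X_{ν i}` as a real number. -/
def spin {N : Fin M → ℕ} (x : Config N) (ν : Fin M) (i : Fin (N ν)) : ℝ := ((x ν i : ℤ) : ℝ)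

/-- The magnetisation `S_ν` of group `ν`. -/
def magnetisation {N : Fin M → ℕ} (x : Config N) (ν : Fin M) : ℝ := ∑ i, spin x ν i

/-- The size of the whole population. -/
def total (N : Fin M → ℕ) : ℕ := ∑ ν, N ν

/-- The energy of a configuration. -/
def hamiltonian (J : Matrix (Fin M) (Fin M) ℝ) {N : Fin M → ℕ} (x : Config N) : ℝ :=
  -(1 / (2 * (total N : ℝ))) *
    ∑ l, ∑ m, J l m * ∑ i : Fin (N l), ∑ j : Fin (N m), spin x l i * spin x m j

/-- The normalisation constant. -/
def partitionFunction (J : Matrix (Fin M) (Fin M) ℝ) (N : Fin M → ℕ) : ℝ :=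
  ∑ x : Config N, Real.exp (-hamiltonian J x)

/-- The canonical ensemble: configuration `x` has probability `Z⁻¹ exp (-H x)`. -/
def gibbs (J : Matrix (Fin M) (Fin M) ℝ) (N : Fin M → ℕ) : Measure (Config N) :=
  ∑ x : Config N,
    ENNReal.ofReal ((partitionFunction J N)⁻¹ * Real.exp (-hamiltonian J x)) • Measure.dirac x

/-- The vector of the centred and normalised sums `N_ν^{-1/2} ∑ i, (X_{ν i} - c ν)`. -/
def fluctuation {N : Fin M → ℕ} (c : Fin M → ℝ) (x : Config N) : EuclideanSpace ℝ (Fin M) :=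
  WithLp.toLp 2 fun ν => (1 / Real.sqrt (N ν)) * ∑ i, (spin x ν i - c ν)

/-- The event that all magnetisations are positive. -/
def allPositive (N : Fin M → ℕ) : Set (Config N) := {x | ∀ ν, 0 < magnetisation x ν}

/-- The event that all magnetisations are negative. -/
def allNegative (N : Fin M → ℕ) : Set (Config N) := {x | ∀ ν, magnetisation x ν < 0}

/-- Weak convergence of a sequence of measures, through bounded continuous test functions. -/
def WeaklyConverges {E : Type*} [TopologicalSpace E] [MeasurableSpace E]
    (μ : ℕ → Measure E) (ν : Measure E) : Prop :=
  ∀ f : BoundedContinuousFunction E ℝ,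
    Tendsto (fun n => ∫ z, f z ∂(μ n)) atTop (𝓝 (∫ z, f z ∂ν))

/-- The two conditional central limit theorems around `m` and `-m` with limit `N(0, E)`.
The matrix `E` is required to be positive semidefinite, so that `N(0, E)` is meaningful. -/
def ConditionalCLT (J : Matrix (Fin M) (Fin M) ℝ) (N : ℕ → Fin M → ℕ) (m : Fin M → ℝ)
    (E : Matrix (Fin M) (Fin M) ℝ) : Prop :=
  E.PosSemidef ∧
  WeaklyConverges
    (fun n => (cond (gibbs J (N n)) (allPositive (N n))).map (fluctuation m))
    (multivariateGaussian 0 E) ∧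
  WeaklyConverges
    (fun n => (cond (gibbs J (N n)) (allNegative (N n))).map (fluctuation (-m)))
    (multivariateGaussian 0 E)

/-- The set of global minimisers of a real function. -/
def globalMinima {X : Type*} (f : X → ℝ) : Set X := {y | ∀ z, f y ≤ f z}

/-- The covariance matrix `diag (1 - m²) + √α Σ √α`. -/
def covariance (α m : Fin M → ℝ) (Sig : Matrix (Fin M) (Fin M) ℝ) :
    Matrix (Fin M) (Fin M) ℝ :=
  Matrix.diagonal (fun l => 1 - m l ^ 2) +
    Matrix.diagonal (fun l => Real.sqrt (α l)) * Sig *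
      Matrix.diagonal (fun l => Real.sqrt (α l))

/-! ### Heterogeneous coupling -/

/-- The function `F y = ½ yᵀ J⁻¹ y - ∑ α_l log cosh y_l`. -/
def potential (J : Matrix (Fin M) (Fin M) ℝ) (α : Fin M → ℝ) (y : Fin M → ℝ) : ℝ :=
  (1 / 2) * (y ⬝ᵥ (J⁻¹).mulVec y) - ∑ l, α l * Real.log (Real.cosh (y l))

/-- The function `F` in the variable `t = tanh y`. -/
def potentialHat (J : Matrix (Fin M) (Fin M) ℝ) (α : Fin M → ℝ) (t : Fin M → ℝ) : ℝ :=
  potential J α fun l => Real.artanh (t l)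

/-- The same function, normalised to vanish at `m`. -/
def potentialTilde (J : Matrix (Fin M) (Fin M) ℝ) (α m : Fin M → ℝ) (t : Fin M → ℝ) : ℝ :=
  potentialHat J α t - potentialHat J α m

/-- The Hessian matrix of `f` at `t`. -/
def hessian (f : (Fin M → ℝ) → ℝ) (t : Fin M → ℝ) : Matrix (Fin M) (Fin M) ℝ :=
  Matrix.of fun l k => fderiv ℝ (fderiv ℝ f) t (Pi.single l 1) (Pi.single k 1)

/-- The low temperature regime of a positive definite coupling matrix: `J⁻¹ - diag α` is neither
positive definite nor positive semidefinite. -/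
def LowTemperature (J : Matrix (Fin M) (Fin M) ℝ) (α : Fin M → ℝ) : Prop :=
  ¬ (J⁻¹ - Matrix.diagonal α).PosSemidef

/-- The conclusion for heterogeneous coupling at the minimiser `x`: with `m = tanh x`, the Hessian
of the normalised potential is the same positive definite matrix at `m` and `-m`, and the
conditional central limit theorems hold with the covariance matrix it determines. -/
def HeterogeneousFluctuations (J : Matrix (Fin M) (Fin M) ℝ) (α : Fin M → ℝ)
    (N : ℕ → Fin M → ℕ) (x : Fin M → ℝ) : Prop :=
  let m : Fin M → ℝ := fun l => Real.tanh (x l)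
  let H : Matrix (Fin M) (Fin M) ℝ := hessian (potentialTilde J α m) m
  H.PosDef ∧ hessian (potentialTilde J α m) (-m) = H ∧
    ConditionalCLT J N m (covariance α m H⁻¹)

/-! ### Homogeneous coupling -/

/-- The one-dimensional analogue of `potential` when all couplings are equal to `β`. -/
def homPotential (β y : ℝ) : ℝ := y ^ 2 / (2 * β) - Real.log (Real.cosh y)

/-- The function `homPotential β` in the variable `t = tanh y`, normalised to vanish at `m`. -/
def homPotentialTilde (β m t : ℝ) : ℝ :=
  homPotential β (Real.artanh t) - homPotential β (Real.artanh m)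

/-- The conclusion for homogeneous coupling at the minimiser `x`. All entries of the matrix that
plays the role of the inverse Hessian are equal to the inverse of the second derivative. -/
def HomogeneousFluctuations (β : ℝ) (α : Fin M → ℝ) (N : ℕ → Fin M → ℕ) (x : ℝ) : Prop :=
  let m : ℝ := Real.tanh x
  let h : ℝ := deriv (deriv (homPotentialTilde β m)) m
  0 < h ∧ deriv (deriv (homPotentialTilde β m)) (-m) = h ∧
    ConditionalCLT (Matrix.of fun _ _ => β) N (fun _ => m)
      (covariance α (fun _ => m) (Matrix.of fun _ _ => h⁻¹))

end CurieWeiss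

end

noncomputable section

namespace CurieWeiss

variable {M : ℕ}

/-! Write the coupling as a Gram matrix, `J l m = ⟪a l, a m⟫`. Then `-H` is the squared norm of `∑
S_ν a_ν` divided by `2N`, and the Hubbard–Stratonovich transformation linearises it: `exp (-H)` is,
up to a constant, a Gaussian integral over a field `v`. For fixed `v` the spins are independent with
means `tanh ⟪a ν, v⟫`, and `v` carries the density `exp (-N F_N v)`, where `F_N` is `freeEnergy`
with the finite-size proportions (`sum_exp_neg_hamiltonian_mul`).

The limiting free energy has two minimisers `±w`, exchanged by the spin flip. On the event that all
magnetisations are positive, fields near `-w` contribute an exponentially small amount. Near `w` put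
`v = w + g / √N`. Laplace's method (`tendsto_laplace`) gives `g` a Gaussian weight whose quadratic
form is the Hessian `‖T g‖²`. For given `g`, the independent spins obey a central limit theorem with
variances `1 - m²` and a shift linear in `g` (`tendsto_indep_charFun`). Integrating over `g` adds
the variance `‖T u‖²` of the shift; this produces the two summands of `E`. Dividing by the value at
`t = 0` removes all prefactors, and Lévy's continuity theorem finishes
(`conditionalCLT_of_freeEnergy`). The negative event follows by flipping the spins.

For homogeneous coupling `V = ℝ` and every `a ν` is `√β`; the proportions enter only through their
sum, so no rate is needed. For positive definite `J = B Bᵀ` the vectors are the rows of `B`, and the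
substitution `y = B v` turns `freeEnergy` into `potential`; here the rate on the proportions makes
the error in the exponent vanish.

It remains to find the minimisers and show them nondegenerate. Both rest on `tanh y / y` being
strictly decreasing and on `y (1 - tanh² y) < tanh y`, used in one dimension directly and for
positive couplings by comparing coordinates where a ratio is maximal. -/

/-! ### Estimates for `tanh` and `log cosh` -/

theorem hasDerivAt_log_cosh (y : ℝ) :
    HasDerivAt (fun y => Real.log (Real.cosh y)) (Real.tanh y) y := by
  rw [Real.tanh_eq_sinh_div_cosh]
  exact (Real.hasDerivAt_cosh y).log (Real.cosh_pos y).ne'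

theorem hasDerivAt_tanh (y : ℝ) : HasDerivAt Real.tanh (1 - Real.tanh y ^ 2) y := by
  have hc := (Real.cosh_pos y).ne'
  have h := (Real.hasDerivAt_sinh y).div (Real.hasDerivAt_cosh y) hc
  have e : Real.tanh = Real.sinh / Real.cosh := by
    ext z; simp [Real.tanh_eq_sinh_div_cosh]
  rw [e]
  convert! h using 1
  simp only [Pi.div_apply]
  field_simp

theorem continuous_log_cosh : Continuous fun y => Real.log (Real.cosh y) :=
  continuous_iff_continuousAt.2 fun y => (hasDerivAt_log_cosh y).continuousAt

/-- A mean value inequality on the segment from `0` to `h`. -/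
theorem abs_sub_le_of_abs_deriv_le {f f' : ℝ → ℝ} {h C : ℝ}
    (hf : ∀ s, HasDerivAt f (f' s) s) (hC : ∀ s, |s| ≤ |h| → |f' s| ≤ C) :
    |f h - f 0| ≤ C * |h| := by
  have := (convex_closedBall (0 : ℝ) |h|).norm_image_sub_le_of_norm_hasDerivWithin_le
    (f := f) (f' := f') (C := C) (fun s _ => (hf s).hasDerivWithinAt)
    (fun s hs => hC s (by simpa using hs)) (x := 0) (y := h) (by simp) (by simp)
  simpa using this

theorem abs_tanh_sub_le (y h : ℝ) : |Real.tanh (y + h) - Real.tanh y| ≤ |h| := by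
  have := abs_sub_le_of_abs_deriv_le (f := fun s => Real.tanh (y + s)) (h := h) (C := 1)
    (fun s => (hasDerivAt_tanh (y + s)).comp_const_add y s) (fun s _ => by
      have h1 := Real.tanh_sq_lt_one (y + s)
      rw [abs_le]; constructor <;> nlinarith [sq_nonneg (Real.tanh (y + s))])
  simpa using this

theorem abs_log_cosh_sub_le (y h : ℝ) :
    |Real.log (Real.cosh (y + h)) - Real.log (Real.cosh y)| ≤ |h| := by
  have := abs_sub_le_of_abs_deriv_le (f := fun s => Real.log (Real.cosh (y + s))) (h := h) (C := 1)
    (fun s => (hasDerivAt_log_cosh (y + s)).comp_const_add y s)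
    (fun s _ => (Real.abs_tanh_lt_one _).le)
  simpa using this

theorem abs_tanh_taylor_le (y h : ℝ) :
    |Real.tanh (y + h) - Real.tanh y - h * (1 - Real.tanh y ^ 2)| ≤ 2 * |h| ^ 2 := by
  have := abs_sub_le_of_abs_deriv_le
    (f := fun s => Real.tanh (y + s) - s * (1 - Real.tanh y ^ 2)) (h := h) (C := 2 * |h|)
    (fun s => ((hasDerivAt_tanh (y + s)).comp_const_add y s).sub
      ((hasDerivAt_id s).mul_const _)) (fun s hs => by
      have h1 := Real.abs_tanh_lt_one (y + s)
      have h2 := Real.abs_tanh_lt_one y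
      have h3 := abs_tanh_sub_le y s
      have : 1 - Real.tanh (y + s) ^ 2 - 1 * (1 - Real.tanh y ^ 2)
        = -((Real.tanh (y + s) + Real.tanh y) * (Real.tanh (y + s) - Real.tanh y)) := by ring
      rw [this, abs_neg, abs_mul]
      have h4 : |Real.tanh (y + s) + Real.tanh y| ≤ 2 := (abs_add_le _ _).trans (by linarith)
      exact mul_le_mul h4 (h3.trans hs) (abs_nonneg _) (by norm_num))
  simp only [add_zero, zero_mul, sub_zero] at this
  calc _ = |Real.tanh (y + h) - h * (1 - Real.tanh y ^ 2) - Real.tanh y| := by congr 1; ring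
    _ ≤ _ := this
    _ = _ := by ring

/-- The derivative of the remainder in `h` is the remainder in `abs_tanh_taylor_le`, so the mean
value inequality applies. The constant is not sharp, but it is independent of `y` and valid for all
`h`, so no smallness of the increment has to be tracked later. -/
theorem abs_log_cosh_taylor_le (y h : ℝ) :
    |Real.log (Real.cosh (y + h)) - Real.log (Real.cosh y) - h * Real.tanh y
      - h ^ 2 / 2 * (1 - Real.tanh y ^ 2)| ≤ 2 * |h| ^ 3 := by
  have := abs_sub_le_of_abs_deriv_le
    (f := fun s => Real.log (Real.cosh (y + s)) - s * Real.tanh y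
      - s ^ 2 / 2 * (1 - Real.tanh y ^ 2)) (h := h) (C := 2 * |h| ^ 2)
    (f' := fun s => Real.tanh (y + s) - Real.tanh y - s * (1 - Real.tanh y ^ 2))
    (fun s => by
      have h1 := (((hasDerivAt_log_cosh (y + s)).comp_const_add y s).sub
        ((hasDerivAt_id s).mul_const (Real.tanh y))).sub
        ((((hasDerivAt_id s).pow 2).div_const 2).mul_const (1 - Real.tanh y ^ 2))
      convert! h1 using 1
      simp) (fun s hs => (abs_tanh_taylor_le y s).trans (by gcongr))
  simp only [add_zero, zero_mul, sub_zero, zero_pow two_ne_zero, zero_div] at this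
  calc _ = |Real.log (Real.cosh (y + h)) - h * Real.tanh y - h ^ 2 / 2 * (1 - Real.tanh y ^ 2)
        - Real.log (Real.cosh y)| := by congr 1; ring
    _ ≤ _ := this
    _ = _ := by ring

theorem one_sub_tanh_sq_pos (y : ℝ) : 0 < 1 - Real.tanh y ^ 2 := by
  linarith [Real.tanh_sq_lt_one y]

theorem log_cosh_nonneg (y : ℝ) : 0 ≤ Real.log (Real.cosh y) :=
  Real.log_nonneg (Real.one_le_cosh y)

theorem log_cosh_le_abs (y : ℝ) : Real.log (Real.cosh y) ≤ |y| := by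
  have := abs_log_cosh_sub_le 0 y
  simp only [zero_add, Real.cosh_zero, Real.log_one, sub_zero] at this
  exact (le_abs_self _).trans this

theorem tanh_pos {y : ℝ} (hy : 0 < y) : 0 < Real.tanh y := by
  rw [Real.tanh_eq_sinh_div_cosh]
  exact div_pos (Real.sinh_pos_iff.2 hy) (Real.cosh_pos y)

/-- After multiplication by `cosh² y` this is `y < sinh y cosh y`. It drives both the monotonicity
of `tanh y / y` and the nondegeneracy of the minimisers. -/
theorem mul_one_sub_tanh_sq_lt {y : ℝ} (hy : 0 < y) :
    y * (1 - Real.tanh y ^ 2) < Real.tanh y := by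
  have hc := Real.cosh_pos y
  have h1 : 1 - Real.tanh y ^ 2 = 1 / Real.cosh y ^ 2 := by
    rw [Real.tanh_eq_sinh_div_cosh]
    field_simp
    linarith [Real.cosh_sq y]
  rw [h1, Real.tanh_eq_sinh_div_cosh, mul_one_div, div_lt_div_iff₀ (by positivity) hc]
  have h2 := Real.self_lt_sinh_iff.2 hy
  have h3 := Real.one_le_cosh y
  have h4 : y < Real.sinh y * Real.cosh y := by nlinarith
  nlinarith

theorem tanh_div_strictAntiOn : StrictAntiOn (fun y => Real.tanh y / y) (Set.Ioi 0) := by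
  have hd : ∀ y ∈ Set.Ioi (0 : ℝ), HasDerivAt (fun y => Real.tanh y / y)
      (((1 - Real.tanh y ^ 2) * y - Real.tanh y * 1) / y ^ 2) y := fun y hy =>
    (hasDerivAt_tanh y).div (hasDerivAt_id y) (ne_of_gt hy)
  refine strictAntiOn_of_deriv_neg (convex_Ioi 0)
    (fun y hy => (hd y hy).continuousAt.continuousWithinAt) fun y hy => ?_
  rw [interior_Ioi] at hy
  rw [(hd y hy).deriv]
  have hy' : 0 < y := hy
  exact div_neg_of_neg_of_pos (by linarith [mul_one_sub_tanh_sq_lt hy']) (by positivity)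

theorem mul_tanh_lt_mul_tanh {a b : ℝ} (ha : 0 < a) (hab : a < b) :
    a * Real.tanh b < b * Real.tanh a := by
  have h := tanh_div_strictAntiOn (a := a) (b := b) ha (ha.trans hab) hab
  have hb := ha.trans hab
  simp only [div_lt_div_iff₀ hb ha] at h
  linarith

/-! ### Independent spins and the spin flip -/

/-- Sums over all configurations of a product over all spins factorise. -/
theorem sum_config_prod {R : Type*} [CommSemiring R] (N : Fin M → ℕ) (f : Fin M → ℤˣ → R) :
    ∑ x : Config N, ∏ ν, ∏ i, f ν (x ν i) = ∏ ν, (f ν 1 + f ν (-1)) ^ N ν := by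
  have h1 : ∀ ν, (f ν 1 + f ν (-1)) ^ N ν = ∑ z : Fin (N ν) → ℤˣ, ∏ i, f ν (z i) := by
    intro ν
    have : f ν 1 + f ν (-1) = ∑ u : ℤˣ, f ν u := by
      rw [show (Finset.univ : Finset ℤˣ) = {1, -1} from rfl, Finset.sum_pair (by decide)]
    rw [this, ← Fintype.piFinset_univ, ← Finset.prod_univ_sum]
    simp
  simp_rw [h1]
  rw [Finset.prod_univ_sum, Fintype.piFinset_univ]
  rfl

/-- The configuration with all spins flipped. -/
def flip {N : Fin M → ℕ} : Config N ≃ Config N where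
  toFun x := fun ν i => -x ν i
  invFun x := fun ν i => -x ν i
  left_inv x := by funext ν i; exact neg_neg _
  right_inv x := by funext ν i; exact neg_neg _

theorem spin_flip {N : Fin M → ℕ} (x : Config N) (ν : Fin M) (i : Fin (N ν)) :
    spin (flip x) ν i = -spin x ν i := by
  change (((-x ν i : ℤˣ) : ℤ) : ℝ) = _
  simp [spin]

theorem magnetisation_flip {N : Fin M → ℕ} (x : Config N) (ν : Fin M) :
    magnetisation (flip x) ν = -magnetisation x ν := by
  simp [magnetisation, spin_flip]

theorem hamiltonian_eq (J : Matrix (Fin M) (Fin M) ℝ) {N : Fin M → ℕ} (x : Config N) :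
    hamiltonian J x = -(1 / (2 * (total N : ℝ))) *
      ∑ l, ∑ m, J l m * (magnetisation x l * magnetisation x m) := by
  simp only [hamiltonian, magnetisation, Finset.sum_mul_sum]

theorem hamiltonian_flip (J : Matrix (Fin M) (Fin M) ℝ) {N : Fin M → ℕ} (x : Config N) :
    hamiltonian J (flip x) = hamiltonian J x := by
  simp [hamiltonian_eq, magnetisation_flip]

theorem fluctuation_apply {N : Fin M → ℕ} (c : Fin M → ℝ) (x : Config N) (ν : Fin M) :
    fluctuation c x ν = (magnetisation x ν - N ν * c ν) / Real.sqrt (N ν) := by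
  simp [fluctuation, magnetisation, Finset.sum_sub_distrib, div_eq_inv_mul]

theorem fluctuation_flip {N : Fin M → ℕ} (c : Fin M → ℝ) (x : Config N) :
    fluctuation (-c) (flip x) = -fluctuation c x := by
  ext ν
  simp only [fluctuation_apply, magnetisation_flip, PiLp.neg_apply, Pi.neg_apply]
  ring

theorem exp_sum_magnetisation {N : Fin M → ℕ} (y : Fin M → ℂ) (x : Config N) :
    Complex.exp (∑ ν, y ν * magnetisation x ν) =
      ∏ ν, ∏ i, Complex.exp (y ν * ((x ν i : ℤ) : ℂ)) := by
  simp only [magnetisation, spin, ← Complex.exp_sum, Complex.ofReal_sum, Finset.mul_sum]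
  simp

/-- The moment generating function of the magnetisations of independent symmetric spins. -/
theorem sum_exp_magnetisation (N : Fin M → ℕ) (y : Fin M → ℂ) :
    ∑ x : Config N, Complex.exp (∑ ν, y ν * magnetisation x ν) =
      ∏ ν, (2 * Complex.cosh (y ν)) ^ N ν := by
  simp_rw [exp_sum_magnetisation]
  rw [sum_config_prod N fun ν u => Complex.exp (y ν * ((u : ℤ) : ℂ))]
  simp [Complex.two_cosh]

/-- The weight of the configuration `x` for independent spins with means `tanh (y ν)`. -/
def indepWeight {N : Fin M → ℕ} (y : Fin M → ℝ) (x : Config N) : ℝ :=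
  Real.exp (∑ ν, y ν * magnetisation x ν) / ∏ ν, (2 * Real.cosh (y ν)) ^ N ν

theorem prod_two_cosh_pos (N : Fin M → ℕ) (y : Fin M → ℝ) :
    0 < ∏ ν, (2 * Real.cosh (y ν)) ^ N ν :=
  Finset.prod_pos fun _ _ => pow_pos (mul_pos two_pos (Real.cosh_pos _)) _

theorem indepWeight_pos {N : Fin M → ℕ} (y : Fin M → ℝ) (x : Config N) : 0 < indepWeight y x :=
  div_pos (Real.exp_pos _) (prod_two_cosh_pos N y)

theorem indepWeight_neg {N : Fin M → ℕ} (y : Fin M → ℝ) (x : Config N) :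
    indepWeight (-y) x = indepWeight y (flip x) := by
  simp [indepWeight, magnetisation_flip]

/-- The characteristic function of the magnetisations of independent spins. -/
theorem sum_indepWeight_mul_exp (N : Fin M → ℕ) (y : Fin M → ℝ) (z : Fin M → ℂ) :
    ∑ x : Config N, (indepWeight y x : ℂ) * Complex.exp (∑ ν, z ν * magnetisation x ν) =
      ∏ ν, (Complex.cosh (y ν + z ν) / Complex.cosh (y ν)) ^ N ν := by
  have h : ∀ x : Config N, (indepWeight y x : ℂ) * Complex.exp (∑ ν, z ν * magnetisation x ν) =
      Complex.exp (∑ ν, (y ν + z ν) * magnetisation x ν) /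
        ∏ ν, (2 * Complex.cosh (y ν)) ^ N ν := by
    intro x
    simp only [indepWeight, add_mul, Finset.sum_add_distrib, Complex.exp_add]
    push_cast
    ring
  simp_rw [h, ← Finset.sum_div]
  rw [sum_exp_magnetisation N fun ν => y ν + z ν, ← Finset.prod_div_distrib]
  refine Finset.prod_congr rfl fun ν _ => ?_
  rw [← div_pow, mul_div_mul_left _ _ two_ne_zero]

theorem sum_indepWeight_mul_rexp (N : Fin M → ℕ) (y z : Fin M → ℝ) :
    ∑ x : Config N, indepWeight y x * Real.exp (∑ ν, z ν * magnetisation x ν) =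
      ∏ ν, (Real.cosh (y ν + z ν) / Real.cosh (y ν)) ^ N ν := by
  have := sum_indepWeight_mul_exp N y fun ν => (z ν : ℂ)
  exact_mod_cast this

theorem sum_indepWeight (N : Fin M → ℕ) (y : Fin M → ℝ) :
    ∑ x : Config N, indepWeight y x = 1 := by
  have := sum_indepWeight_mul_rexp N y 0
  simpa [(Real.cosh_pos _).ne'] using this

open Classical in
/-- A Chernoff bound for a nonpositive magnetisation of independent spins. -/
theorem sum_indepWeight_nonpos_le (N : Fin M → ℕ) (y : Fin M → ℝ) (ν : Fin M) (hy : 0 ≤ y ν) :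
    ∑ x : Config N, (if magnetisation x ν ≤ 0 then indepWeight y x else 0) ≤
      (Real.cosh (y ν))⁻¹ ^ N ν := by
  -- Tilting by `-y ν` cancels the field of group `ν`: the numerator becomes `cosh 0 = 1`.
  have h := sum_indepWeight_mul_rexp N y (Pi.single ν (-y ν))
  rw [Finset.prod_eq_single ν] at h
  · simp only [Pi.single_eq_same, add_neg_cancel, Real.cosh_zero, one_div] at h
    rw [← h]
    refine Finset.sum_le_sum fun x _ => ?_
    have hs : ∑ μ, (Pi.single ν (-y ν) : Fin M → ℝ) μ * magnetisation x μ =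
        -y ν * magnetisation x ν := by
      rw [Finset.sum_eq_single ν] <;> simp +contextual
    rw [hs]
    split_ifs with hx
    · refine le_mul_of_one_le_right (indepWeight_pos y x).le (Real.one_le_exp ?_)
      nlinarith
    · exact mul_nonneg (indepWeight_pos y x).le (Real.exp_pos _).le
  · intro μ _ hμ
    simp [hμ, (Real.cosh_pos _).ne']
  · simp

/-! ### The central limit theorem for independent spins -/

/-- Since `K g` converges, `g → 0`, and `K (log (1 + g) - g)` is of order `‖K g‖ ‖g‖`, hence
vanishes. The principal logarithm is harmless near `1`. -/
theorem tendsto_one_add_pow_exp {g : ℕ → ℂ} {K : ℕ → ℕ} {w : ℂ} (hK : Tendsto K atTop atTop)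
    (h : Tendsto (fun n => (K n : ℂ) * g n) atTop (𝓝 w)) :
    Tendsto (fun n => (1 + g n) ^ K n) atTop (𝓝 (Complex.exp w)) := by
  have hKi : Tendsto (fun n => (K n : ℂ)⁻¹) atTop (𝓝 0) := by
    have := (Complex.continuous_ofReal.tendsto _).comp
      ((tendsto_inv_atTop_nhds_zero_nat (𝕜 := ℝ)).comp hK)
    rw [Complex.ofReal_zero] at this
    exact this.congr fun n => by simp
  have hg : Tendsto g atTop (𝓝 0) := by
    have := h.mul hKi
    rw [mul_zero] at this
    refine this.congr' ?_
    filter_upwards [hK.eventually_gt_atTop 0] with n hn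
    have : (K n : ℂ) ≠ 0 := by exact_mod_cast hn.ne'
    field_simp
  have hsmall : ∀ᶠ n in atTop, ‖g n‖ < 1 / 2 := by
    have := hg.norm
    rw [norm_zero] at this
    exact this.eventually_lt_const (by norm_num)
  have hlog : Tendsto (fun n => (K n : ℂ) * Complex.log (1 + g n)) atTop (𝓝 w) := by
    have hdiff : Tendsto (fun n => (K n : ℂ) * Complex.log (1 + g n) - (K n : ℂ) * g n) atTop
        (𝓝 0) := by
      have hb : Tendsto (fun n => ‖(K n : ℂ) * g n‖ * ‖g n‖) atTop (𝓝 0) := by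
        simpa using h.norm.mul hg.norm
      refine squeeze_zero_norm' ?_ hb
      filter_upwards [hsmall] with n hn
      rw [← mul_sub, norm_mul, norm_mul, mul_assoc]
      refine mul_le_mul_of_nonneg_left ?_ (norm_nonneg _)
      refine (Complex.norm_log_one_add_sub_self_le (hn.trans (by norm_num))).trans ?_
      have : (1 - ‖g n‖)⁻¹ ≤ 2 := by
        rw [inv_le_comm₀ (by linarith) (by norm_num)]; linarith
      nlinarith [sq_nonneg ‖g n‖]
    simpa using hdiff.add h
  refine ((Complex.continuous_exp.tendsto _).comp hlog).congr' ?_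
  filter_upwards [hsmall] with n hn
  have : 1 + g n ≠ 0 := by
    intro h0
    have : g n = -1 := by linear_combination h0
    rw [this] at hn
    norm_num at hn
  simp only [Function.comp]
  rw [Complex.exp_nat_mul, Complex.exp_log this]

theorem tendsto_mul_exp_sub_one_sub {K : ℕ → ℕ} (hK : Tendsto K atTop atTop) (c : ℂ) :
    Tendsto (fun n => (K n : ℂ) *
      (Complex.exp (c / Real.sqrt (K n)) - 1 - c / Real.sqrt (K n))) atTop (𝓝 (c ^ 2 / 2)) := by
  have hs : Tendsto (fun n => Real.sqrt (K n)) atTop atTop :=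
    Real.tendsto_sqrt_atTop.comp (tendsto_natCast_atTop_atTop.comp hK)
  rw [← tendsto_sub_nhds_zero_iff]
  have hb : Tendsto (fun n => ‖c‖ ^ 3 * Real.exp ‖c‖ * (Real.sqrt (K n))⁻¹) atTop (𝓝 0) := by
    simpa using (tendsto_inv_atTop_zero.comp hs).const_mul (‖c‖ ^ 3 * Real.exp ‖c‖)
  refine squeeze_zero_norm' ?_ hb
  filter_upwards [hs.eventually_ge_atTop 1] with n hn
  set s := Real.sqrt (K n) with hsdef
  have hs0 : 0 < s := by linarith
  have hKs : (K n : ℂ) = (s : ℂ) ^ 2 := by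
    rw [← Complex.ofReal_pow, hsdef, Real.sq_sqrt (Nat.cast_nonneg _)]; simp
  have hsc : (s : ℂ) ≠ 0 := by exact_mod_cast hs0.ne'
  have e : (K n : ℂ) * (Complex.exp (c / s) - 1 - c / s) - c ^ 2 / 2 =
      (s : ℂ) ^ 2 * (Complex.exp (c / s) - ∑ k ∈ Finset.range 3, (c / s) ^ k / (k.factorial : ℂ)) := by
    rw [hKs]
    simp [Finset.sum_range_succ]
    field_simp
    ring
  rw [e, norm_mul, norm_pow, Complex.norm_real, Real.norm_of_nonneg hs0.le]
  have hcs : ‖c / s‖ = ‖c‖ / s := by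
    rw [norm_div, Complex.norm_real, Real.norm_of_nonneg hs0.le]
  have h1 := Complex.norm_exp_sub_sum_le_norm_mul_exp (c / s) 3
  rw [hcs] at h1
  have h2 : ‖c‖ / s ≤ ‖c‖ := div_le_self (norm_nonneg _) hn
  calc _ ≤ s ^ 2 * ((‖c‖ / s) ^ 3 * Real.exp (‖c‖ / s)) := by gcongr
    _ ≤ s ^ 2 * ((‖c‖ / s) ^ 3 * Real.exp ‖c‖) := by gcongr
    _ = _ := by field_simp

/-- The characteristic function of one spin: the values `±1` have probabilities `(1 ± tanh y) / 2`.
-/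
theorem cosh_add_mul_I_div_cosh (y θ : ℝ) :
    Complex.cosh (y + θ * Complex.I) / Complex.cosh y =
      (1 + Real.tanh y) / 2 * Complex.exp (θ * Complex.I) +
        (1 - Real.tanh y) / 2 * Complex.exp (-(θ * Complex.I)) := by
  have h : Complex.cosh y ≠ 0 := by
    rw [← Complex.ofReal_cosh]; exact_mod_cast (Real.cosh_pos y).ne'
  rw [Complex.ofReal_tanh, Complex.tanh_eq_sinh_div_cosh, Complex.cosh_add,
    Complex.cosh, Complex.sinh, Complex.cosh, Complex.sinh] at *
  have h' : Complex.exp y + Complex.exp (-y) ≠ 0 := fun h0 => h (by rw [h0, zero_div])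
  field_simp
  ring

theorem tendsto_spin_charFun_pow {K : ℕ → ℕ} (hK : Tendsto K atTop atTop) {y : ℕ → ℝ} {m r : ℝ}
    (t : ℝ) (h : Tendsto (fun n => Real.sqrt (K n) * (Real.tanh (y n) - m)) atTop (𝓝 r)) :
    Tendsto (fun n => (Complex.exp (-((t / Real.sqrt (K n) * m : ℝ) * Complex.I)) *
      (Complex.cosh (y n + (t / Real.sqrt (K n) : ℝ) * Complex.I) / Complex.cosh (y n))) ^ K n)
      atTop (𝓝 (Complex.exp (t * r * Complex.I - (1 - m ^ 2) * t ^ 2 / 2))) := by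
  have hs : Tendsto (fun n => Real.sqrt (K n)) atTop atTop :=
    Real.tendsto_sqrt_atTop.comp (tendsto_natCast_atTop_atTop.comp hK)
  have hτ : Tendsto (fun n => Real.tanh (y n)) atTop (𝓝 m) := by
    rw [← tendsto_sub_nhds_zero_iff]
    have := (tendsto_inv_atTop_zero.comp hs).mul h
    rw [zero_mul] at this
    refine this.congr' ?_
    filter_upwards [hs.eventually_gt_atTop 0] with n hn
    simp only [Function.comp]
    field_simp
  have hτc : Tendsto (fun n => (Real.tanh (y n) : ℂ)) atTop (𝓝 m) :=
    (Complex.continuous_ofReal.tendsto _).comp hτ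
  have hc : Tendsto (fun n => ((Real.sqrt (K n) * (Real.tanh (y n) - m) : ℝ) : ℂ)) atTop (𝓝 r) :=
    (Complex.continuous_ofReal.tendsto _).comp h
  -- After centring at `m` the spin takes the values `1 - m` and `-(1 + m)`. The second-order terms
  -- give the variance `1 - m²`. The first-order terms add up to `tanh (y n) - m`, which survives at
  -- the scale `√K` as the shift `r`.
  have h1 := tendsto_mul_exp_sub_one_sub hK (t * (1 - m) * Complex.I)
  have h2 := tendsto_mul_exp_sub_one_sub hK (-(t * (1 + m) * Complex.I))
  have key := (((hτc.const_add 1).div_const 2).mul h1).add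
    ((((hτc.const_sub 1).div_const 2).mul h2).add (hc.const_mul (t * Complex.I)))
  have hlim : (1 + (m : ℂ)) / 2 * ((t * (1 - m) * Complex.I) ^ 2 / 2) +
      ((1 - (m : ℂ)) / 2 * ((-(t * (1 + m) * Complex.I)) ^ 2 / 2) + t * Complex.I * r) =
      t * r * Complex.I - (1 - m ^ 2) * t ^ 2 / 2 := by
    ring_nf
    simp only [Complex.I_sq]
    ring
  rw [hlim] at key
  refine (tendsto_one_add_pow_exp (g := fun n => Complex.exp (-((t / Real.sqrt (K n) * m : ℝ) *
    Complex.I)) * (Complex.cosh (y n + (t / Real.sqrt (K n) : ℝ) * Complex.I) /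
      Complex.cosh (y n)) - 1) hK ?_).congr fun n => by rw [add_sub_cancel]
  refine key.congr' ?_
  filter_upwards [hs.eventually_gt_atTop 0] with n hn
  set s := Real.sqrt (K n) with hsdef
  have hKs : (K n : ℂ) = (s : ℂ) ^ 2 := by
    rw [← Complex.ofReal_pow, hsdef, Real.sq_sqrt (Nat.cast_nonneg _)]; simp
  have hsc : (s : ℂ) ≠ 0 := by exact_mod_cast hn.ne'
  have e0 : ∀ a b c p q : ℂ, Complex.exp a * (p * Complex.exp b + q * Complex.exp c) =
      p * Complex.exp (a + b) + q * Complex.exp (a + c) := by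
    intro a b c p q
    rw [Complex.exp_add, Complex.exp_add]
    ring
  rw [cosh_add_mul_I_div_cosh, e0, hKs]
  have e1 : -(((t / s * m : ℝ) : ℂ) * Complex.I) + ((t / s : ℝ) : ℂ) * Complex.I =
      t * (1 - m) * Complex.I / s := by
    push_cast; field_simp; ring
  have e2 : -(((t / s * m : ℝ) : ℂ) * Complex.I) + -(((t / s : ℝ) : ℂ) * Complex.I) =
      -(t * (1 + m) * Complex.I) / s := by
    push_cast; field_simp; ring
  rw [e1, e2]
  push_cast
  field_simp
  ring

theorem inner_fluctuation {N : Fin M → ℕ} (m : Fin M → ℝ) (x : Config N)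
    (t : EuclideanSpace ℝ (Fin M)) :
    inner ℝ (fluctuation m x) t =
      ∑ ν, (t ν / Real.sqrt (N ν)) * magnetisation x ν - ∑ ν, N ν * (t ν / Real.sqrt (N ν) * m ν) := by
  rw [PiLp.inner_apply, ← Finset.sum_sub_distrib]
  refine Finset.sum_congr rfl fun ν _ => ?_
  rw [fluctuation_apply]
  simp
  ring

theorem sum_indepWeight_mul_cexp_inner (N : Fin M → ℕ) (y m : Fin M → ℝ)
    (t : EuclideanSpace ℝ (Fin M)) :
    ∑ x : Config N, (indepWeight y x : ℂ) *
        Complex.exp ((inner ℝ (fluctuation m x) t : ℝ) * Complex.I) =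
      ∏ ν, (Complex.exp (-((t ν / Real.sqrt (N ν) * m ν : ℝ) * Complex.I)) *
        (Complex.cosh (y ν + (t ν / Real.sqrt (N ν) : ℝ) * Complex.I) /
          Complex.cosh (y ν))) ^ N ν := by
  simp_rw [mul_pow]
  rw [Finset.prod_mul_distrib, ← sum_indepWeight_mul_exp N y fun ν =>
    (t ν / Real.sqrt (N ν) : ℝ) * Complex.I, Finset.mul_sum]
  refine Finset.sum_congr rfl fun x _ => ?_
  rw [mul_left_comm]
  congr 1
  simp_rw [← Complex.exp_nat_mul]
  rw [← Complex.exp_sum, ← Complex.exp_add, inner_fluctuation]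
  congr 1
  push_cast
  rw [sub_mul, Finset.sum_mul, Finset.sum_mul]
  have : ∀ a b c : ℂ, a * b * c = a * c * b := fun a b c => by ring
  rw [sub_eq_neg_add, ← Finset.sum_neg_distrib]
  congr 1
  · exact Finset.sum_congr rfl fun ν _ => by ring
  · exact Finset.sum_congr rfl fun ν _ => by ring

/-- A central limit theorem for independent spins with varying means. -/
theorem tendsto_indep_charFun {N : ℕ → Fin M → ℕ} (hN : ∀ ν, Tendsto (fun n => N n ν) atTop atTop)
    {y : ℕ → Fin M → ℝ} {m r : Fin M → ℝ} (t : EuclideanSpace ℝ (Fin M))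
    (h : ∀ ν, Tendsto (fun n => Real.sqrt (N n ν) * (Real.tanh (y n ν) - m ν)) atTop (𝓝 (r ν))) :
    Tendsto (fun n => ∑ x : Config (N n), (indepWeight (y n) x : ℂ) *
        Complex.exp ((inner ℝ (fluctuation m x) t : ℝ) * Complex.I)) atTop
      (𝓝 (Complex.exp ((∑ ν, t ν * r ν : ℝ) * Complex.I -
        (∑ ν, (1 - m ν ^ 2) * t ν ^ 2 : ℝ) / 2))) := by
  simp_rw [sum_indepWeight_mul_cexp_inner]
  have e : Complex.exp ((∑ ν, t ν * r ν : ℝ) * Complex.I -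
        (∑ ν, (1 - m ν ^ 2) * t ν ^ 2 : ℝ) / 2) =
      ∏ ν, Complex.exp (t ν * r ν * Complex.I - (1 - m ν ^ 2) * t ν ^ 2 / 2) := by
    rw [← Complex.exp_sum, Finset.sum_sub_distrib]
    push_cast
    rw [Finset.sum_mul, Finset.sum_div]
  rw [e]
  exact tendsto_finsetProd _ fun ν _ => tendsto_spin_charFun_pow (hN ν) (t ν) (h ν)

/-! ### The free energy of the field and its minimisers -/

section FreeEnergy

variable {V : Type*} [NormedAddCommGroup V] [InnerProductSpace ℝ V]

/-- The free energy of the vector `v` of the linearised model with fields `⟪a ν, v⟫`. -/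
def freeEnergy (a : Fin M → V) (p : Fin M → ℝ) (v : V) : ℝ :=
  ‖v‖ ^ 2 / 2 - ∑ ν, p ν * Real.log (Real.cosh (inner ℝ (a ν) v))

/-- The quadratic form of second derivatives of the free energy. -/
def freeHessian (a : Fin M → V) (p : Fin M → ℝ) (w g : V) : ℝ :=
  ‖g‖ ^ 2 - ∑ ν, p ν * (1 - Real.tanh (inner ℝ (a ν) w) ^ 2) * inner ℝ (a ν) g ^ 2

/-- The derivative of the free energy at `w` in direction `g`. -/
def freeGradient (a : Fin M → V) (p : Fin M → ℝ) (w g : V) : ℝ :=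
  inner ℝ w g - ∑ ν, p ν * Real.tanh (inner ℝ (a ν) w) * inner ℝ (a ν) g

theorem continuous_freeEnergy (a : Fin M → V) (p : Fin M → ℝ) : Continuous (freeEnergy a p) := by
  unfold freeEnergy
  refine ((continuous_norm.pow 2).div_const 2).sub (continuous_finsetSum _ fun ν _ => ?_)
  exact continuous_const.mul
    (continuous_log_cosh.comp (continuous_const.inner continuous_id))

theorem freeEnergy_neg (a : Fin M → V) (p : Fin M → ℝ) (v : V) :
    freeEnergy a p (-v) = freeEnergy a p v := by
  simp [freeEnergy]

/-- The norm term is exactly quadratic, so the error comes only from `log cosh`, whose cubic bound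
is global. -/
theorem exists_freeEnergy_taylor_le (a : Fin M → V) (p : Fin M → ℝ) (w : V) :
    ∃ C, 0 ≤ C ∧ ∀ g, |freeEnergy a p (w + g) - freeEnergy a p w - freeGradient a p w g
      - freeHessian a p w g / 2| ≤ C * ‖g‖ ^ 3 := by
  refine ⟨∑ ν, |p ν| * (2 * ‖a ν‖ ^ 3), Finset.sum_nonneg fun ν _ => by positivity, fun g => ?_⟩
  have e : freeEnergy a p (w + g) - freeEnergy a p w - freeGradient a p w g
      - freeHessian a p w g / 2 = - ∑ ν, p ν * (Real.log (Real.cosh (inner ℝ (a ν) w +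
        inner ℝ (a ν) g)) - Real.log (Real.cosh (inner ℝ (a ν) w))
        - inner ℝ (a ν) g * Real.tanh (inner ℝ (a ν) w)
        - inner ℝ (a ν) g ^ 2 / 2 * (1 - Real.tanh (inner ℝ (a ν) w) ^ 2)) := by
    simp only [freeEnergy, freeGradient, freeHessian, inner_add_right, norm_add_sq_real,
      mul_sub, Finset.sum_sub_distrib, sub_div, Finset.sum_div]
    have h1 : ∑ ν, p ν * (inner ℝ (a ν) g * Real.tanh (inner ℝ (a ν) w)) =
        ∑ ν, p ν * Real.tanh (inner ℝ (a ν) w) * inner ℝ (a ν) g :=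
      Finset.sum_congr rfl fun ν _ => by ring
    have h2 : ∑ ν, (p ν * 1 - p ν * Real.tanh (inner ℝ (a ν) w) ^ 2) * inner ℝ (a ν) g ^ 2 / 2 =
        ∑ ν, p ν * (inner ℝ (a ν) g ^ 2 / 2 * 1) -
          ∑ ν, p ν * (inner ℝ (a ν) g ^ 2 / 2 * Real.tanh (inner ℝ (a ν) w) ^ 2) := by
      rw [← Finset.sum_sub_distrib]
      exact Finset.sum_congr rfl fun ν _ => by ring
    rw [h1, h2]
    ring
  rw [e, abs_neg, Finset.sum_mul]
  refine (Finset.abs_sum_le_sum_abs _ _).trans (Finset.sum_le_sum fun ν _ => ?_)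
  rw [abs_mul, mul_assoc]
  refine mul_le_mul_of_nonneg_left ((abs_log_cosh_taylor_le _ _).trans ?_) (abs_nonneg _)
  have := abs_real_inner_le_norm (a ν) g
  calc 2 * |inner ℝ (a ν) g| ^ 3 ≤ 2 * (‖a ν‖ * ‖g‖) ^ 3 := by gcongr
    _ = _ := by ring

theorem freeGradient_smul (a : Fin M → V) (p : Fin M → ℝ) (w g : V) (s : ℝ) :
    freeGradient a p w (s • g) = s * freeGradient a p w g := by
  simp only [freeGradient, inner_smul_right, mul_sub, Finset.mul_sum]
  congr 1
  exact Finset.sum_congr rfl fun ν _ => by ring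

theorem freeHessian_smul (a : Fin M → V) (p : Fin M → ℝ) (w g : V) (s : ℝ) :
    freeHessian a p w (s • g) = s ^ 2 * freeHessian a p w g := by
  simp only [freeHessian, inner_smul_right, mul_sub, Finset.mul_sum, norm_smul, mul_pow,
    Real.norm_eq_abs, sq_abs]
  congr 1
  exact Finset.sum_congr rfl fun ν _ => by ring

/-- A linear function of `s` dominated by a quadratic one vanishes. -/
theorem eq_zero_of_mul_add_sq_nonneg {L D : ℝ} (h : ∀ s : ℝ, |s| ≤ 1 → 0 ≤ s * L + D * s ^ 2) :
    L = 0 := by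
  have hD : 0 ≤ D := by
    have h1 := h 1 (by norm_num)
    have h2 := h (-1) (by norm_num)
    linarith
  by_contra hL
  have hpos : 0 < |L| := abs_pos.2 hL
  have hden : 0 < |L| + D + 1 := by positivity
  -- The term `|L|` in the denominator keeps `|s| ≤ 1`, and `D + 1` makes the quadratic term too
  -- small to compensate the linear one.
  have h1 := h (-L / (|L| + D + 1)) (by
    rw [abs_div, abs_neg, abs_of_pos hden, div_le_one hden]; linarith)
  have e : -L / (|L| + D + 1) * L + D * (-L / (|L| + D + 1)) ^ 2 =
      -(L ^ 2 * (|L| + 1)) / (|L| + D + 1) ^ 2 := by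
    field_simp
    ring
  rw [e] at h1
  have : -(L ^ 2 * (|L| + 1)) / (|L| + D + 1) ^ 2 < 0 :=
    div_neg_of_neg_of_pos (by have := sq_pos_of_ne_zero hL; nlinarith) (by positivity)
  linarith

theorem freeGradient_eq_zero {a : Fin M → V} {p : Fin M → ℝ} {w : V}
    (hw : w ∈ globalMinima (freeEnergy a p)) (g : V) : freeGradient a p w g = 0 := by
  obtain ⟨C, hC, hT⟩ := exists_freeEnergy_taylor_le a p w
  refine eq_zero_of_mul_add_sq_nonneg (D := |freeHessian a p w g| / 2 + C * ‖g‖ ^ 3) fun s hs => ?_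
  have h1 := (abs_le.1 (hT (s • g))).2
  have h2 := hw (w + s • g)
  rw [freeGradient_smul, freeHessian_smul, norm_smul, mul_pow, Real.norm_eq_abs] at h1
  have h3 : |s| ^ 3 ≤ s ^ 2 := by
    rw [← sq_abs s]
    exact pow_le_pow_of_le_one (abs_nonneg s) hs (by norm_num)
  have h4 : C * (|s| ^ 3 * ‖g‖ ^ 3) ≤ C * (s ^ 2 * ‖g‖ ^ 3) := by gcongr
  have h5 : s ^ 2 * freeHessian a p w g ≤ s ^ 2 * |freeHessian a p w g| :=
    mul_le_mul_of_nonneg_left (le_abs_self _) (sq_nonneg s)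
  nlinarith

theorem freeHessian_nonneg {a : Fin M → V} {p : Fin M → ℝ} {w : V}
    (hw : w ∈ globalMinima (freeEnergy a p)) (g : V) : 0 ≤ freeHessian a p w g := by
  obtain ⟨C, hC, hT⟩ := exists_freeEnergy_taylor_le a p w
  by_contra hneg
  push Not at hneg
  set q := freeHessian a p w g with hq
  have hd : 0 < 4 * (C * ‖g‖ ^ 3 + 1) := by positivity
  -- With this `s` the cubic error is at most `-q s² / 4`, half the size of the negative quadratic
  -- term `q s² / 2`.
  set s := -q / (4 * (C * ‖g‖ ^ 3 + 1)) with hs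
  have hs0 : 0 < s := div_pos (by linarith) hd
  have h1 := (abs_le.1 (hT (s • g))).2
  have h2 := hw (w + s • g)
  rw [freeGradient_eq_zero hw, freeHessian_smul, norm_smul, mul_pow, Real.norm_of_nonneg hs0.le,
    ← hq] at h1
  have h3 : s * (4 * (C * ‖g‖ ^ 3 + 1)) = -q := by rw [hs]; field_simp
  have h4 : s ^ 2 * (s * (4 * (C * ‖g‖ ^ 3 + 1))) = s ^ 2 * -q := by rw [h3]
  have h5 : 0 < s ^ 2 * -q := mul_pos (by positivity) (by linarith)
  have h6 : 0 < s ^ 3 := by positivity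
  nlinarith

theorem tendsto_mul_freeEnergy_sub {a : Fin M → V} {p : Fin M → ℝ} {w : V}
    (hw : w ∈ globalMinima (freeEnergy a p)) (g : V) {s : ℕ → ℝ} (hs : Tendsto s atTop atTop) :
    Tendsto (fun n => s n ^ 2 * (freeEnergy a p (w + (s n)⁻¹ • g) - freeEnergy a p w)) atTop
      (𝓝 (freeHessian a p w g / 2)) := by
  obtain ⟨C, hC, hT⟩ := exists_freeEnergy_taylor_le a p w
  rw [← tendsto_sub_nhds_zero_iff]
  have hb : Tendsto (fun n => C * ‖g‖ ^ 3 * (s n)⁻¹) atTop (𝓝 0) := by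
    simpa using (tendsto_inv_atTop_zero.comp hs).const_mul (C * ‖g‖ ^ 3)
  refine squeeze_zero_norm' ?_ hb
  filter_upwards [hs.eventually_gt_atTop 0] with n hn
  have h1 := hT ((s n)⁻¹ • g)
  rw [freeGradient_eq_zero hw, freeHessian_smul, norm_smul, norm_inv, Real.norm_of_nonneg hn.le]
    at h1
  rw [Real.norm_eq_abs]
  have e : s n ^ 2 * (freeEnergy a p (w + (s n)⁻¹ • g) - freeEnergy a p w)
      - freeHessian a p w g / 2 = s n ^ 2 * (freeEnergy a p (w + (s n)⁻¹ • g) - freeEnergy a p w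
        - 0 - (s n)⁻¹ ^ 2 * freeHessian a p w g / 2) := by
    field_simp
    ring
  rw [e, abs_mul, abs_of_pos (by positivity)]
  calc _ ≤ s n ^ 2 * (C * ((s n)⁻¹ * ‖g‖) ^ 3) := by gcongr
    _ = _ := by field_simp

/-- Because `log cosh` grows at most linearly, the quadratic term dominates at infinity. -/
theorem freeEnergy_ge (a : Fin M → V) (p : Fin M → ℝ) (v : V) :
    ‖v‖ ^ 2 / 2 - (∑ ν, |p ν| * ‖a ν‖) * ‖v‖ ≤ freeEnergy a p v := by
  unfold freeEnergy
  rw [Finset.sum_mul]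
  refine sub_le_sub_left (Finset.sum_le_sum fun ν _ => ?_) _
  calc p ν * Real.log (Real.cosh (inner ℝ (a ν) v))
      ≤ |p ν| * Real.log (Real.cosh (inner ℝ (a ν) v)) :=
        mul_le_mul_of_nonneg_right (le_abs_self _) (log_cosh_nonneg _)
    _ ≤ |p ν| * (‖a ν‖ * ‖v‖) := mul_le_mul_of_nonneg_left
        ((log_cosh_le_abs _).trans (abs_real_inner_le_norm _ _)) (abs_nonneg _)
    _ = _ := by ring

/-- The closed half space of vectors at an acute or right angle with `w`. -/
def halfSpace (w : V) : Set V := {v | 0 ≤ inner ℝ v w}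

/-- Quadratic growth of the free energy on the half space around one of its two minimisers. -/
theorem exists_quadratic_growth [FiniteDimensional ℝ V] {a : Fin M → V} {p : Fin M → ℝ} {w : V}
    (hw : globalMinima (freeEnergy a p) = {w, -w}) {c₀ : ℝ} (hc₀ : 0 < c₀)
    (hq : ∀ g, c₀ * ‖g‖ ^ 2 ≤ freeHessian a p w g) :
    ∃ c, 0 < c ∧ ∀ v, 0 ≤ inner ℝ v w →
      c * ‖v - w‖ ^ 2 ≤ freeEnergy a p v - freeEnergy a p w := by
  have hwm : w ∈ globalMinima (freeEnergy a p) := by rw [hw]; simp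
  obtain ⟨C, hC, hT⟩ := exists_freeEnergy_taylor_le a p w
  set A := ∑ ν, |p ν| * ‖a ν‖ with hA
  have hA0 : 0 ≤ A := Finset.sum_nonneg fun ν _ => by positivity
  set B := A * ‖w‖ + |freeEnergy a p w| with hB
  have hB0 : 0 ≤ B := by positivity
  -- Beyond distance `R` the linear and constant losses are absorbed by part of the quadratic term,
  -- leaving the coefficient `1 / 4`.
  set R := 4 * (‖w‖ + A + B) + 1 with hR
  have hR1 : 1 ≤ R := by have := norm_nonneg w; rw [hR]; linarith
  have hfar : ∀ v, R ≤ ‖v - w‖ → 1 / 4 * ‖v - w‖ ^ 2 ≤ freeEnergy a p v - freeEnergy a p w := by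
    intro v hv
    set r := ‖v - w‖ with hr
    have h1 := freeEnergy_ge a p v
    rw [← hA] at h1
    have h2 : ‖v‖ ≤ r + ‖w‖ := by simpa using norm_add_le (v - w) w
    have h3 : r ≤ ‖v‖ + ‖w‖ := norm_sub_le v w
    have h4 := le_abs_self (freeEnergy a p w)
    have hwn := norm_nonneg w
    have h5 : (r - ‖w‖) ^ 2 ≤ ‖v‖ ^ 2 := by
      apply pow_le_pow_left₀ _ (by linarith)
      linarith
    have h6 : A * ‖v‖ ≤ A * (r + ‖w‖) := mul_le_mul_of_nonneg_left h2 hA0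
    have h7 : R * r ≤ r * r := by nlinarith
    have h8 : B ≤ B * r := by nlinarith
    rw [hR] at h7
    nlinarith [sq_nonneg ‖w‖]
  -- Within distance `δ` the cubic Taylor error costs at most half of the quadratic term `c₀ / 2 *
  -- ‖v - w‖ ^ 2`.
  set δ := c₀ / (4 * (C + 1)) with hδ
  have hδ0 : 0 < δ := by positivity
  have hnear : ∀ v, ‖v - w‖ ≤ δ →
      c₀ / 4 * ‖v - w‖ ^ 2 ≤ freeEnergy a p v - freeEnergy a p w := by
    intro v hv
    have h1 := (abs_le.1 (hT (v - w))).1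
    rw [freeGradient_eq_zero hwm, add_sub_cancel] at h1
    have h2 := hq (v - w)
    have h3 : C * ‖v - w‖ ≤ c₀ / 4 := by
      have : C * ‖v - w‖ ≤ (C + 1) * δ := mul_le_mul (by linarith) hv (norm_nonneg _) (by linarith)
      have e : (C + 1) * δ = c₀ / 4 := by rw [hδ]; field_simp
      linarith
    have h4 : C * ‖v - w‖ ^ 3 ≤ c₀ / 4 * ‖v - w‖ ^ 2 := by
      calc C * ‖v - w‖ ^ 3 = C * ‖v - w‖ * ‖v - w‖ ^ 2 := by ring
        _ ≤ _ := by gcongr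
    linarith
  set K : Set V := {v | 0 ≤ inner ℝ v w ∧ δ ≤ ‖v - w‖ ∧ ‖v - w‖ ≤ R} with hK
  have hKc : IsCompact K := by
    refine (isCompact_closedBall w R).of_isClosed_subset ?_ fun v hv => ?_
    · have h1 : IsClosed {v : V | 0 ≤ inner ℝ v w} :=
        isClosed_le continuous_const (continuous_id.inner continuous_const)
      have h2 : IsClosed {v : V | δ ≤ ‖v - w‖} := isClosed_le continuous_const (by fun_prop)
      have h3 : IsClosed {v : V | ‖v - w‖ ≤ R} := isClosed_le (by fun_prop) continuous_const
      exact h1.inter (h2.inter h3)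
    · rw [mem_closedBall_iff_norm]
      exact hv.2.2
  -- The half space excludes the other minimiser: `-w` lies in it only if `w = 0`, and then `-w =
  -- w`, which is too close to `w` to be in `K`. On the compact `K` the gap therefore has a positive
  -- minimum.
  have hpos : ∀ v ∈ K, 0 < freeEnergy a p v - freeEnergy a p w := by
    intro v hv
    refine sub_pos.2 (lt_of_le_of_ne (hwm v) fun heq => ?_)
    have hv' : v ∈ globalMinima (freeEnergy a p) := fun z => heq ▸ hwm z
    rw [hw] at hv'
    have hvw : v ≠ w := by
      rintro rfl
      have := hv.2.1
      rw [sub_self, norm_zero] at this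
      linarith
    rcases hv' with h | h
    · exact hvw h
    · rw [Set.mem_singleton_iff] at h
      have h1 := hv.1
      rw [h, inner_neg_left, real_inner_self_eq_norm_sq] at h1
      have h2 : ‖w‖ = 0 := by
        have := norm_nonneg w
        nlinarith [sq_nonneg ‖w‖]
      rw [norm_eq_zero] at h2
      exact hvw (by rw [h, h2, neg_zero])
  obtain ⟨μ, hμ0, hμ⟩ : ∃ μ, 0 < μ ∧ ∀ v ∈ K, μ ≤ freeEnergy a p v - freeEnergy a p w := by
    rcases K.eq_empty_or_nonempty with h | h
    · exact ⟨1, one_pos, by simp [h]⟩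
    · obtain ⟨v₀, hv₀, hmin⟩ := hKc.exists_isMinOn h
        (((continuous_freeEnergy a p).sub continuous_const).continuousOn
          (f := fun v => freeEnergy a p v - freeEnergy a p w))
      exact ⟨_, hpos v₀ hv₀, fun v hv => hmin hv⟩
  refine ⟨min (1 / 4) (min (c₀ / 4) (μ / R ^ 2)), by positivity, fun v hv => ?_⟩
  rcases le_total R ‖v - w‖ with h | h
  · refine le_trans ?_ (hfar v h)
    gcongr
    exact min_le_left _ _
  rcases le_total ‖v - w‖ δ with h' | h'
  · refine le_trans ?_ (hnear v h')
    gcongr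
    exact (min_le_right _ _).trans (min_le_left _ _)
  · refine le_trans ?_ (hμ v ⟨hv, h', h⟩)
    calc _ ≤ μ / R ^ 2 * R ^ 2 := by
          gcongr
          exact (min_le_right _ _).trans (min_le_right _ _)
      _ = μ := by field_simp

end FreeEnergy

/-! ### Laplace's method -/

section Laplace

variable {V : Type*} [NormedAddCommGroup V] [InnerProductSpace ℝ V] [FiniteDimensional ℝ V]
  [MeasurableSpace V] [BorelSpace V]

theorem integrable_exp_neg_mul_norm_sq {b : ℝ} (hb : 0 < b) :
    Integrable (fun v : V => Real.exp (-b * ‖v‖ ^ 2)) := by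
  have := (GaussianFourier.integrable_cexp_neg_mul_sq_norm_add (V := V) (b := b)
    (by simpa using hb) 0 0).norm
  refine this.congr (ae_of_all _ fun v => ?_)
  simp [Complex.norm_exp, ← Complex.ofReal_pow]

/-- Laplace's method around one of the two minimisers of the free energy. -/
theorem tendsto_laplace {a : Fin M → V} {p : ℕ → Fin M → ℝ} {α : Fin M → ℝ} {w : V} (hw0 : w ≠ 0)
    (hw : globalMinima (freeEnergy a α) = {w, -w}) {c₀ : ℝ} (hc₀ : 0 < c₀)
    (hq : ∀ g, c₀ * ‖g‖ ^ 2 ≤ freeHessian a α w g)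
    {s : ℕ → ℝ} (hs : Tendsto s atTop atTop) {ε : ℕ → ℝ} (hε : Tendsto ε atTop (𝓝 0))
    (hp : ∀ n v, |s n * ∑ ν, (p n ν - α ν) * (Real.log (Real.cosh (inner ℝ (a ν) v)) -
      Real.log (Real.cosh (inner ℝ (a ν) w)))| ≤ ε n * ‖v - w‖)
    {R : ℕ → V → ℂ} (hR : ∀ n, Measurable (R n)) (hR1 : ∀ n v, ‖R n v‖ ≤ 1) {ℓ : V → ℂ}
    (hℓ : ∀ g, Tendsto (fun n => R n (w + (s n)⁻¹ • g)) atTop (𝓝 (ℓ g))) :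
    Tendsto (fun n => ∫ g : V, (halfSpace w).indicator (fun v =>
        (Real.exp (-(s n ^ 2 * (freeEnergy a (p n) v - freeEnergy a (p n) w))) : ℂ) * R n v)
          (w + (s n)⁻¹ • g)) atTop
      (𝓝 (∫ g : V, (Real.exp (-(freeHessian a α w g / 2)) : ℂ) * ℓ g)) := by
  obtain ⟨c, hc, hgrow⟩ := exists_quadratic_growth hw hc₀ hq
  have hwm : w ∈ globalMinima (freeEnergy a α) := by rw [hw]; simp
  -- The finite-size free energy differs from its limit only through the proportions. By `hp` this
  -- difference, at scale `s n ^ 2` and distance `‖g‖ / s n` from `w`, is at most `ε n * ‖g‖`.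
  have hdiff : ∀ n v, freeEnergy a (p n) v - freeEnergy a (p n) w =
      freeEnergy a α v - freeEnergy a α w - ∑ ν, (p n ν - α ν) *
        (Real.log (Real.cosh (inner ℝ (a ν) v)) - Real.log (Real.cosh (inner ℝ (a ν) w))) := by
    intro n v
    simp only [freeEnergy, sub_mul, mul_sub, Finset.sum_sub_distrib]
    ring
  have hscale : ∀ n g, 0 < s n →
      |s n ^ 2 * ∑ ν, (p n ν - α ν) * (Real.log (Real.cosh (inner ℝ (a ν) (w + (s n)⁻¹ • g))) -
        Real.log (Real.cosh (inner ℝ (a ν) w)))| ≤ ε n * ‖g‖ := by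
    intro n g hn
    have h1 := hp n (w + (s n)⁻¹ • g)
    rw [add_sub_cancel_left, norm_smul, norm_inv, Real.norm_of_nonneg hn.le] at h1
    rw [pow_two, mul_assoc, abs_mul, abs_of_pos hn]
    calc _ ≤ s n * (ε n * ((s n)⁻¹ * ‖g‖)) := by gcongr
      _ = _ := by field_simp
  have hmeasU : MeasurableSet (halfSpace w) :=
    (isClosed_le continuous_const (continuous_id.inner continuous_const)).measurableSet
  -- Quadratic growth yields `exp (-c ‖g‖²)` and the varying proportions cost at most `exp ‖g‖` once
  -- `ε n ≤ 1`. Completing the square in `‖g‖ ≤ c / 2 * ‖g‖² + 1 / (2 c)` gives the dominating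
  -- function.
  refine tendsto_integral_filter_of_dominated_convergence
    (fun g => Real.exp (1 / (2 * c)) * Real.exp (-(c / 2) * ‖g‖ ^ 2)) ?_ ?_ ?_ ?_
  · refine Eventually.of_forall fun n => Measurable.aestronglyMeasurable ?_
    have h1 : Measurable fun v => (Real.exp (-(s n ^ 2 * (freeEnergy a (p n) v -
        freeEnergy a (p n) w))) : ℂ) := by
      have := continuous_freeEnergy a (p n)
      exact (by fun_prop : Continuous _).measurable
    exact ((h1.mul (hR n)).indicator hmeasU).comp (by fun_prop)
  · filter_upwards [hs.eventually_gt_atTop 0, hε.eventually_le_const (u := 1) (by norm_num)]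
      with n hn hεn
    refine ae_of_all _ fun g => ?_
    by_cases hU : w + (s n)⁻¹ • g ∈ (halfSpace w)
    · rw [Set.indicator_of_mem hU, norm_mul, Complex.norm_real,
        Real.norm_of_nonneg (Real.exp_pos _).le, ← Real.exp_add]
      refine (mul_le_of_le_one_right (Real.exp_pos _).le (hR1 _ _)).trans (Real.exp_le_exp.2 ?_)
      have h1 := hgrow _ hU
      rw [add_sub_cancel_left, norm_smul, norm_inv, Real.norm_of_nonneg hn.le] at h1
      have h2 : c * ‖g‖ ^ 2 ≤ s n ^ 2 *
          (freeEnergy a α (w + (s n)⁻¹ • g) - freeEnergy a α w) := by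
        calc c * ‖g‖ ^ 2 = s n ^ 2 * (c * ((s n)⁻¹ * ‖g‖) ^ 2) := by field_simp
          _ ≤ _ := by gcongr
      have h3 := (abs_le.1 (hscale n g hn)).2
      have h4 : ε n * ‖g‖ ≤ 1 * ‖g‖ := by gcongr
      rw [hdiff, mul_sub]
      have h5 : ‖g‖ ≤ c / 2 * ‖g‖ ^ 2 + 1 / (2 * c) := by
        have : c / 2 * ‖g‖ ^ 2 + 1 / (2 * c) - ‖g‖ = (c * ‖g‖ - 1) ^ 2 / (2 * c) := by
          field_simp
          ring
        have h6 : 0 ≤ (c * ‖g‖ - 1) ^ 2 / (2 * c) := by positivity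
        linarith
      linarith
    · rw [Set.indicator_of_notMem hU, norm_zero]
      positivity
  · exact (integrable_exp_neg_mul_norm_sq (by positivity)).const_mul _
  · refine ae_of_all _ fun g => ?_
    have hlim : Tendsto (fun n => w + (s n)⁻¹ • g) atTop (𝓝 w) := by
      simpa using ((tendsto_inv_atTop_zero.comp hs).smul_const g).const_add w
    -- Since `w ≠ 0` is an interior point of the half space, the indicator disappears in the limit
    -- for each fixed `g`.
    have hU : ∀ᶠ n in atTop, w + (s n)⁻¹ • g ∈ (halfSpace w) := by
      have h1 : Tendsto (fun n => inner ℝ (w + (s n)⁻¹ • g) w) atTop (𝓝 (inner ℝ w w)) :=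
        hlim.inner tendsto_const_nhds
      exact (h1.eventually_const_lt (real_inner_self_pos.2 hw0)).mono fun n hn => hn.le
    have hsum : Tendsto (fun n => s n ^ 2 * ∑ ν, (p n ν - α ν) *
        (Real.log (Real.cosh (inner ℝ (a ν) (w + (s n)⁻¹ • g))) -
          Real.log (Real.cosh (inner ℝ (a ν) w)))) atTop (𝓝 0) := by
      refine squeeze_zero_norm' ?_ (by simpa using hε.mul_const ‖g‖)
      filter_upwards [hs.eventually_gt_atTop 0] with n hn using hscale n g hn
    have hexp : Tendsto (fun n => s n ^ 2 * (freeEnergy a (p n) (w + (s n)⁻¹ • g) -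
        freeEnergy a (p n) w)) atTop (𝓝 (freeHessian a α w g / 2)) := by
      have := (tendsto_mul_freeEnergy_sub hwm g hs).sub hsum
      rw [sub_zero] at this
      refine this.congr fun n => ?_
      rw [hdiff]
      ring
    have hfin := ((Complex.continuous_ofReal.tendsto _).comp
      ((Real.continuous_exp.tendsto _).comp hexp.neg)).mul (hℓ g)
    refine hfin.congr' ?_
    filter_upwards [hU] with n hn
    rw [Set.indicator_of_mem hn]
    rfl

end Laplace

/-! ### The Hubbard–Stratonovich transformation -/

section HubbardStratonovich

variable {V : Type*} [NormedAddCommGroup V] [InnerProductSpace ℝ V]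

theorem neg_mul_norm_sq_add_inner {b : ℝ} (hb : 0 < b) (z v : V) :
    -(b / 2) * ‖v‖ ^ 2 + inner ℝ z v =
      -(b / 2) * ‖v - b⁻¹ • z‖ ^ 2 + ‖z‖ ^ 2 / (2 * b) := by
  rw [norm_sub_sq_real, norm_smul, inner_smul_right, real_inner_comm, Real.norm_of_nonneg
    (inv_pos.2 hb).le]
  field_simp
  ring

/-- The vector of magnetisations in the linearised model. -/
def magnetisationVector (a : Fin M → V) {N : Fin M → ℕ} (x : Config N) : V :=
  ∑ ν, magnetisation x ν • a ν

theorem neg_hamiltonian_eq {a : Fin M → V} {J : Matrix (Fin M) (Fin M) ℝ}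
    (hJ : ∀ l m, J l m = inner ℝ (a l) (a m)) {N : Fin M → ℕ} (x : Config N) :
    -hamiltonian J x = ‖magnetisationVector a x‖ ^ 2 / (2 * total N) := by
  rw [hamiltonian_eq, ← real_inner_self_eq_norm_sq, magnetisationVector]
  simp only [sum_inner, inner_sum, inner_smul_left, inner_smul_right, hJ, Finset.mul_sum]
  simp only [← Finset.sum_neg_distrib, Finset.sum_div]
  refine Finset.sum_congr rfl fun l _ => Finset.sum_congr rfl fun m _ => ?_
  rw [real_inner_comm (a l) (a m)]
  simp
  ring

/-- The expectation of `φ` for independent spins in the fields `⟪a ν, v⟫`. -/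
def fieldExpectation (a : Fin M → V) {N : Fin M → ℕ} (φ : Config N → ℂ) (v : V) : ℂ :=
  ∑ x : Config N, (indepWeight (fun ν => inner ℝ (a ν) v) x : ℂ) * φ x

theorem continuous_indepWeight_inner (a : Fin M → V) {N : Fin M → ℕ} (x : Config N) :
    Continuous fun v : V => indepWeight (fun ν => inner ℝ (a ν) v) x := by
  unfold indepWeight
  refine Continuous.div ?_ ?_ fun v => (prod_two_cosh_pos N _).ne'
  · fun_prop
  · refine continuous_finsetProd _ fun ν _ => ?_
    have := Real.continuous_cosh
    fun_prop

theorem continuous_fieldExpectation (a : Fin M → V) {N : Fin M → ℕ} (φ : Config N → ℂ) :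
    Continuous (fieldExpectation a φ) :=
  continuous_finsetSum _ fun x _ =>
    (Complex.continuous_ofReal.comp (continuous_indepWeight_inner a x)).mul continuous_const

theorem norm_fieldExpectation_le (a : Fin M → V) {N : Fin M → ℕ} {φ : Config N → ℂ}
    (hφ : ∀ x, ‖φ x‖ ≤ 1) (v : V) : ‖fieldExpectation a φ v‖ ≤ 1 := by
  rw [← sum_indepWeight N fun ν => inner ℝ (a ν) v]
  refine (norm_sum_le _ _).trans (Finset.sum_le_sum fun x _ => ?_)
  rw [norm_mul, Complex.norm_real, Real.norm_of_nonneg (indepWeight_pos _ _).le]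
  exact mul_le_of_le_one_right (indepWeight_pos _ _).le (hφ x)

/-- The proportions of the groups. -/
def proportion (N : Fin M → ℕ) (ν : Fin M) : ℝ := (N ν : ℝ) / total N

/-- This is the decoupling identity: the joint density of configuration and field factors into a
density of the field and an independent-spin law given the field. The product of the normalisers `2
cosh` supplies both `2 ^ N` and the `log cosh` terms of the free energy. -/
theorem exp_inner_magnetisationVector (a : Fin M → V) {N : Fin M → ℕ} (hN : 0 < total N)
    (x : Config N) (v : V) :
    Real.exp (-((total N : ℝ) / 2) * ‖v‖ ^ 2 + inner ℝ (magnetisationVector a x) v) =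
      2 ^ total N * (Real.exp (-(total N * freeEnergy a (proportion N) v)) *
        indepWeight (fun ν => inner ℝ (a ν) v) x) := by
  have hN' : (total N : ℝ) ≠ 0 := by exact_mod_cast hN.ne'
  have h1 : inner ℝ (magnetisationVector a x) v = ∑ ν, inner ℝ (a ν) v * magnetisation x ν := by
    simp [magnetisationVector, sum_inner, inner_smul_left, mul_comm]
  have h2 : ∏ ν, (2 * Real.cosh (inner ℝ (a ν) v)) ^ N ν =
      2 ^ total N * Real.exp (∑ ν, N ν * Real.log (Real.cosh (inner ℝ (a ν) v))) := by
    simp_rw [mul_pow, Finset.prod_mul_distrib, Finset.prod_pow_eq_pow_sum, Real.exp_sum,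
      Real.exp_nat_mul, Real.exp_log (Real.cosh_pos _)]
    rfl
  have h3 : (total N : ℝ) * freeEnergy a (proportion N) v = total N / 2 * ‖v‖ ^ 2 -
      ∑ ν, N ν * Real.log (Real.cosh (inner ℝ (a ν) v)) := by
    rw [freeEnergy, mul_sub, Finset.mul_sum]
    congr 1
    · ring
    · refine Finset.sum_congr rfl fun ν _ => ?_
      rw [proportion]
      field_simp
  rw [indepWeight, h2, h1, h3, Real.exp_add, neg_sub, Real.exp_sub, neg_mul, Real.exp_neg]
  field_simp

variable [FiniteDimensional ℝ V] [MeasurableSpace V] [BorelSpace V]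

theorem integrable_exp_neg_mul_norm_sq_add_inner {b : ℝ} (hb : 0 < b) (z : V) :
    Integrable fun v : V => Real.exp (-(b / 2) * ‖v‖ ^ 2 + inner ℝ z v) := by
  simp_rw [neg_mul_norm_sq_add_inner hb z, Real.exp_add]
  exact ((integrable_exp_neg_mul_norm_sq (V := V) (half_pos hb)).comp_sub_right _).mul_const _

/-- The Hubbard–Stratonovich transformation. -/
theorem integral_exp_neg_mul_norm_sq_add_inner {b : ℝ} (hb : 0 < b) (z : V) :
    ∫ v : V, Real.exp (-(b / 2) * ‖v‖ ^ 2 + inner ℝ z v) =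
      (∫ v : V, Real.exp (-(b / 2) * ‖v‖ ^ 2)) * Real.exp (‖z‖ ^ 2 / (2 * b)) := by
  simp_rw [neg_mul_norm_sq_add_inner hb z, Real.exp_add, integral_mul_const]
  rw [integral_sub_right_eq_self (fun v : V => Real.exp (-(b / 2) * ‖v‖ ^ 2))]

/-- Each Boltzmann weight becomes a Gaussian integral, and the finite sum over configurations moves
inside. Integrability is recorded because the integral is later split between half spaces. -/
theorem sum_exp_neg_hamiltonian_mul {a : Fin M → V} {J : Matrix (Fin M) (Fin M) ℝ}
    (hJ : ∀ l m, J l m = inner ℝ (a l) (a m)) {N : Fin M → ℕ} (hN : 0 < total N)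
    (φ : Config N → ℂ) :
    Integrable (fun v : V => (Real.exp (-(total N * freeEnergy a (proportion N) v)) : ℂ) *
      fieldExpectation a φ v) ∧
    ((∫ v : V, Real.exp (-((total N : ℝ) / 2) * ‖v‖ ^ 2) : ℝ) : ℂ) *
        ∑ x, (Real.exp (-hamiltonian J x) : ℂ) * φ x =
      2 ^ total N * ∫ v : V, (Real.exp (-(total N * freeEnergy a (proportion N) v)) : ℂ) *
        fieldExpectation a φ v := by
  have hN' : (0 : ℝ) < total N := by exact_mod_cast hN
  have e : ∀ v : V, (2 : ℂ) ^ total N * ((Real.exp (-(total N * freeEnergy a (proportion N) v)) : ℂ)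
      * fieldExpectation a φ v) = ∑ x : Config N, ((Real.exp (-((total N : ℝ) / 2) * ‖v‖ ^ 2 +
        inner ℝ (magnetisationVector a x) v) : ℝ) : ℂ) * φ x := by
    intro v
    rw [fieldExpectation, Finset.mul_sum, Finset.mul_sum]
    refine Finset.sum_congr rfl fun x _ => ?_
    rw [exp_inner_magnetisationVector a hN]
    push_cast
    ring
  have hint : ∀ x : Config N, Integrable fun v : V => ((Real.exp (-((total N : ℝ) / 2) * ‖v‖ ^ 2 +
        inner ℝ (magnetisationVector a x) v) : ℝ) : ℂ) * φ x := fun x =>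
    (integrable_exp_neg_mul_norm_sq_add_inner hN' _).ofReal.mul_const _
  constructor
  · have h1 := (integrable_finsetSum Finset.univ fun x _ => hint x)
    simp_rw [← e] at h1
    exact (integrable_const_mul_iff (isUnit_iff_ne_zero.2 (pow_ne_zero _ two_ne_zero)) _).1 h1
  · rw [← integral_const_mul]
    simp_rw [e]
    rw [integral_finsetSum _ fun x _ => hint x, Finset.mul_sum]
    refine Finset.sum_congr rfl fun x _ => ?_
    rw [integral_mul_const, integral_complex_ofReal,
      integral_exp_neg_mul_norm_sq_add_inner hN', neg_hamiltonian_eq hJ]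
    push_cast
    ring

/-- The open half space of vectors at an acute angle with `w`. -/
def openHalfSpace (w : V) : Set V := {v | 0 < inner ℝ v w}

/-- The complement of the closed half space is reflected onto the open one. The outer indicator of
`halfSpace w` in the second integral is redundant but gives both terms the form required by
`tendsto_laplace`, so that only the minimiser `w` ever has to be treated. -/
theorem integral_eq_integral_halfSpace (w : V) {h : V → ℂ} (hh : Integrable h) :
    ∫ v, h v = (∫ v, (halfSpace w).indicator h v) +
      ∫ v, (halfSpace w).indicator (fun v => (openHalfSpace w).indicator
        (fun v => h (-v)) v) v := by
  have hU : MeasurableSet (halfSpace w) :=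
    (isClosed_le continuous_const (continuous_id.inner continuous_const)).measurableSet
  rw [← integral_add_compl hU hh, integral_indicator hU, ← integral_indicator hU.compl]
  congr 1
  rw [← integral_neg_eq_self]
  congr 1
  funext v
  by_cases hv : v ∈ openHalfSpace w
  · have h1 : v ∈ halfSpace w := (show (0 : ℝ) < inner ℝ v w from hv).le
    have h2 : -v ∈ (halfSpace w)ᶜ := by
      simpa [halfSpace, openHalfSpace, inner_neg_left] using hv
    rw [Set.indicator_of_mem h2, Set.indicator_of_mem h1, Set.indicator_of_mem hv]
  · have h2 : -v ∉ (halfSpace w)ᶜ := by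
      simpa [halfSpace, openHalfSpace, inner_neg_left] using hv
    rw [Set.indicator_of_notMem h2]
    by_cases h1 : v ∈ halfSpace w
    · rw [Set.indicator_of_mem h1, Set.indicator_of_notMem hv]
    · rw [Set.indicator_of_notMem h1]

theorem integral_comp_add_inv_smul (w : V) {s : ℝ} (hs : 0 < s) (h : V → ℂ) :
    ∫ g, h (w + s⁻¹ • g) = ((s ^ Module.finrank ℝ V : ℝ) : ℂ) * ∫ v, h v := by
  rw [Measure.integral_comp_inv_smul volume (fun v => h (w + v)) s,
    integral_add_left_eq_self h w, abs_of_pos (by positivity), Complex.real_smul]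

end HubbardStratonovich

/-! ### Gaussian integrals with a general quadratic form -/

section GaussianIntegral

variable {V : Type*} [NormedAddCommGroup V] [InnerProductSpace ℝ V]

theorem exists_mul_norm_sq_le (T : V ≃L[ℝ] V) : ∃ c₀, 0 < c₀ ∧ ∀ g, c₀ * ‖g‖ ^ 2 ≤ ‖T g‖ ^ 2 := by
  set K := ‖(T.symm : V →L[ℝ] V)‖ + 1 with hK
  have hK0 : 0 < K := by positivity
  refine ⟨(K ^ 2)⁻¹, by positivity, fun g => ?_⟩
  have h1 : ‖g‖ ≤ K * ‖T g‖ := by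
    calc ‖g‖ = ‖(T.symm : V →L[ℝ] V) (T g)‖ := by simp
      _ ≤ ‖(T.symm : V →L[ℝ] V)‖ * ‖T g‖ := ContinuousLinearMap.le_opNorm _ _
      _ ≤ _ := by gcongr; linarith
  rw [inv_mul_le_iff₀ (by positivity), ← mul_pow]
  gcongr

variable [FiniteDimensional ℝ V] [MeasurableSpace V] [BorelSpace V]

/-- The substitution `h = T g` reduces this to the standard Gaussian. Its Jacobian occurs on both
sides and need not be computed. -/
theorem integral_gaussian_fourier (T : V ≃L[ℝ] V) (u : V) :
    ∫ g : V, (Real.exp (-(‖T g‖ ^ 2 / 2)) : ℂ) * Complex.exp ((inner ℝ (T u) (T g) : ℝ) * Complex.I)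
      = (Real.exp (-(‖T u‖ ^ 2 / 2)) : ℂ) * ∫ g : V, (Real.exp (-(‖T g‖ ^ 2 / 2)) : ℂ) := by
  have hdet : LinearMap.det (T : V →ₗ[ℝ] V) ≠ 0 := T.toLinearEquiv.isUnit_det'.ne_zero
  have hchange : ∀ f : V → ℂ, ∫ g, f (T g) =
      |(LinearMap.det (T : V →ₗ[ℝ] V))⁻¹| • ∫ h, f h := by
    intro f
    have h1 := (T.toHomeomorph.measurableEmbedding).integral_map (μ := volume) f
    have h2 := Measure.map_linearMap_addHaar_eq_smul_addHaar (volume : Measure V) hdet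
    have e : (T.toHomeomorph : V → V) = (T : V →ₗ[ℝ] V) := rfl
    rw [e, h2, integral_smul_measure, ENNReal.toReal_ofReal (abs_nonneg _)] at h1
    exact h1.symm
  have e : ∀ h : V, (Real.exp (-(‖h‖ ^ 2 / 2)) : ℂ) * Complex.exp ((inner ℝ (T u) h : ℝ) * Complex.I)
      = Complex.exp (-(1 / 2 : ℂ) * ‖h‖ ^ 2 + Complex.I * (inner ℝ (T u) h : ℝ)) := by
    intro h
    rw [Complex.ofReal_exp, ← Complex.exp_add]
    congr 1
    push_cast
    ring
  have e' : ∀ h : V, (Real.exp (-(‖h‖ ^ 2 / 2)) : ℂ) = Complex.exp (-(1 / 2 : ℂ) * ‖h‖ ^ 2) := by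
    intro h
    rw [Complex.ofReal_exp]
    congr 1
    push_cast
    ring
  have hre : 0 < (1 / 2 : ℂ).re := by norm_num
  rw [hchange fun h => (Real.exp (-(‖h‖ ^ 2 / 2)) : ℂ) *
    Complex.exp ((inner ℝ (T u) h : ℝ) * Complex.I),
    hchange fun h => (Real.exp (-(‖h‖ ^ 2 / 2)) : ℂ)]
  simp_rw [e]
  rw [GaussianFourier.integral_cexp_neg_mul_sq_norm_add hre]
  simp_rw [e']
  rw [GaussianFourier.integral_cexp_neg_mul_sq_norm hre, mul_smul_comm]
  congr 1
  rw [mul_comm]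
  congr 2
  rw [Complex.I_sq]
  ring

theorem integral_exp_neg_norm_sq_equiv_ne_zero (T : V ≃L[ℝ] V) {c₀ : ℝ} (hc₀ : 0 < c₀)
    (hT : ∀ g, c₀ * ‖g‖ ^ 2 ≤ ‖T g‖ ^ 2) :
    ∫ g : V, (Real.exp (-(‖T g‖ ^ 2 / 2)) : ℂ) ≠ 0 := by
  rw [integral_complex_ofReal, Complex.ofReal_ne_zero]
  refine (integral_exp_pos ?_).ne'
  refine (integrable_exp_neg_mul_norm_sq (V := V) (half_pos hc₀)).mono'
    (by have := T.continuous; exact (by fun_prop : Continuous _).aestronglyMeasurable)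
    (ae_of_all _ fun g => ?_)
  rw [Real.norm_of_nonneg (Real.exp_pos _).le]
  exact Real.exp_le_exp.2 (by have := hT g; linarith)

end GaussianIntegral

/-! ### Restriction to positive magnetisations -/

theorem tendsto_total [Nonempty (Fin M)] {N : ℕ → Fin M → ℕ}
    (hN : ∀ ν, Tendsto (fun n => N n ν) atTop atTop) :
    Tendsto (fun n => total (N n)) atTop atTop := by
  obtain ⟨ν⟩ := ‹Nonempty (Fin M)›
  exact tendsto_atTop_mono (fun n => Finset.single_le_sum (f := N n) (fun _ _ => Nat.zero_le _)
    (Finset.mem_univ ν)) (hN ν)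

theorem tendsto_pow_atTop_zero {b : ℕ → ℝ} {c : ℝ} {K : ℕ → ℕ} (hb0 : ∀ n, 0 ≤ b n)
    (hb : Tendsto b atTop (𝓝 c)) (hc : c < 1) (hK : Tendsto K atTop atTop) :
    Tendsto (fun n => b n ^ K n) atTop (𝓝 0) := by
  have hc0 : 0 ≤ c := ge_of_tendsto' hb hb0
  have h := (tendsto_pow_atTop_nhds_zero_of_lt_one (r := (c + 1) / 2) (by linarith)
    (by linarith)).comp hK
  refine squeeze_zero' (Eventually.of_forall fun n => pow_nonneg (hb0 n) _) ?_ h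
  filter_upwards [hb.eventually_le_const (u := (c + 1) / 2) (by linarith)] with n hn
  exact pow_le_pow_left₀ (hb0 n) hn _

open Classical in
-- A union bound over the groups, each handled by the Chernoff bound.
theorem sum_indepWeight_not_allPositive_le (N : Fin M → ℕ) {y : Fin M → ℝ} (hy : ∀ ν, 0 ≤ y ν) :
    ∑ x : Config N, (if ∃ ν, magnetisation x ν ≤ 0 then indepWeight y x else 0) ≤
      ∑ ν, (Real.cosh (y ν))⁻¹ ^ N ν := by
  refine le_trans ?_ (Finset.sum_le_sum fun ν _ => sum_indepWeight_nonpos_le N y ν (hy ν))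
  rw [Finset.sum_comm]
  refine Finset.sum_le_sum fun x _ => ?_
  have hnn : ∀ ν ∈ Finset.univ, 0 ≤ if magnetisation x ν ≤ 0 then indepWeight y x else 0 := by
    intro ν _
    split_ifs
    · exact (indepWeight_pos y x).le
    · exact le_rfl
  split_ifs with h
  · obtain ⟨ν, hν⟩ := h
    refine le_trans ?_ (Finset.single_le_sum hnn (Finset.mem_univ ν))
    rw [if_pos hν]
  · exact Finset.sum_nonneg hnn

open Classical in
/-- The random phase of the fluctuations in direction `t`, on the event that all magnetisations are
positive. -/
def positivePhase {N : Fin M → ℕ} (m : Fin M → ℝ) (t : EuclideanSpace ℝ (Fin M)) (x : Config N) :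
    ℂ :=
  if x ∈ allPositive N then Complex.exp ((inner ℝ (fluctuation m x) t : ℝ) * Complex.I) else 0

theorem norm_positivePhase_le {N : Fin M → ℕ} (m : Fin M → ℝ) (t : EuclideanSpace ℝ (Fin M))
    (x : Config N) : ‖positivePhase m t x‖ ≤ 1 := by
  unfold positivePhase
  split_ifs
  · rw [Complex.norm_exp_ofReal_mul_I]
  · simp

theorem tendsto_sum_inv_cosh_pow {N : ℕ → Fin M → ℕ}
    (hN : ∀ ν, Tendsto (fun n => N n ν) atTop atTop) {y : ℕ → Fin M → ℝ} {x : Fin M → ℝ}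
    (hx : ∀ ν, 0 < x ν) (hy : ∀ ν, Tendsto (fun n => y n ν) atTop (𝓝 (x ν))) :
    Tendsto (fun n => ∑ ν, (Real.cosh (y n ν))⁻¹ ^ N n ν) atTop (𝓝 0) := by
  rw [← Finset.sum_const_zero (s := (Finset.univ : Finset (Fin M)))]
  refine tendsto_finsetSum _ fun ν _ => ?_
  refine tendsto_pow_atTop_zero (fun n => (inv_pos.2 (Real.cosh_pos _)).le)
    (((Real.continuous_cosh.tendsto _).comp (hy ν)).inv₀ (Real.cosh_pos _).ne') ?_ (hN ν)
  exact inv_lt_one_of_one_lt₀ (Real.one_lt_cosh.2 (hx ν).ne')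

/-- With fields bounded away from `0`, the event has probability tending to one, so restricting to
it does not change the limit of the unrestricted characteristic function. -/
theorem tendsto_indep_positivePhase {N : ℕ → Fin M → ℕ}
    (hN : ∀ ν, Tendsto (fun n => N n ν) atTop atTop)
    {y : ℕ → Fin M → ℝ} {x m r : Fin M → ℝ} (t : EuclideanSpace ℝ (Fin M))
    (hx : ∀ ν, 0 < x ν) (hy : ∀ ν, Tendsto (fun n => y n ν) atTop (𝓝 (x ν)))
    (h : ∀ ν, Tendsto (fun n => Real.sqrt (N n ν) * (Real.tanh (y n ν) - m ν)) atTop (𝓝 (r ν))) :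
    Tendsto (fun n => ∑ x : Config (N n), (indepWeight (y n) x : ℂ) * positivePhase m t x) atTop
      (𝓝 (Complex.exp ((∑ ν, t ν * r ν : ℝ) * Complex.I -
        (∑ ν, (1 - m ν ^ 2) * t ν ^ 2 : ℝ) / 2))) := by
  classical
  have h1 := tendsto_indep_charFun hN t h
  have hev : ∀ᶠ n in atTop, ∀ ν, 0 ≤ y n ν :=
    eventually_all.2 fun ν => ((hy ν).eventually_const_lt (hx ν)).mono fun n hn => hn.le
  refine h1.congr_dist ?_
  refine squeeze_zero' (Eventually.of_forall fun n => dist_nonneg) ?_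
    (tendsto_sum_inv_cosh_pow hN hx hy)
  filter_upwards [hev] with n hn
  refine le_trans ?_ (sum_indepWeight_not_allPositive_le (N n) hn)
  rw [dist_eq_norm, ← Finset.sum_sub_distrib]
  refine (norm_sum_le _ _).trans (Finset.sum_le_sum fun x _ => ?_)
  rw [← mul_sub, norm_mul, Complex.norm_real, Real.norm_of_nonneg (indepWeight_pos _ _).le]
  unfold positivePhase
  by_cases hpos : x ∈ allPositive (N n)
  · rw [if_pos hpos, sub_self, norm_zero, mul_zero]
    split_ifs
    · exact (indepWeight_pos _ _).le
    · exact le_rfl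
  · rw [if_neg hpos, sub_zero, Complex.norm_exp_ofReal_mul_I, mul_one, if_pos]
    simpa [allPositive] using hpos

/-- Under the opposite fields, positivity of all magnetisations is a large deviation; flipping the
spins turns it into the event just bounded. At least one group is needed, since otherwise the event
is everything. -/
theorem tendsto_indep_neg_positivePhase [Nonempty (Fin M)] {N : ℕ → Fin M → ℕ}
    (hN : ∀ ν, Tendsto (fun n => N n ν) atTop atTop)
    {y : ℕ → Fin M → ℝ} {x m : Fin M → ℝ} (t : EuclideanSpace ℝ (Fin M))
    (hx : ∀ ν, 0 < x ν) (hy : ∀ ν, Tendsto (fun n => y n ν) atTop (𝓝 (x ν))) :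
    Tendsto (fun n => ∑ x : Config (N n), (indepWeight (-y n) x : ℂ) * positivePhase m t x) atTop
      (𝓝 0) := by
  classical
  have hev : ∀ᶠ n in atTop, ∀ ν, 0 ≤ y n ν :=
    eventually_all.2 fun ν => ((hy ν).eventually_const_lt (hx ν)).mono fun n hn => hn.le
  refine squeeze_zero_norm' ?_ (tendsto_sum_inv_cosh_pow hN hx hy)
  filter_upwards [hev] with n hn
  refine le_trans ?_ (sum_indepWeight_not_allPositive_le (N n) hn)
  rw [← Equiv.sum_comp flip fun x => if ∃ ν, magnetisation x ν ≤ 0 then indepWeight (y n) x else 0]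
  refine (norm_sum_le _ _).trans (Finset.sum_le_sum fun x _ => ?_)
  rw [norm_mul, Complex.norm_real, Real.norm_of_nonneg (indepWeight_pos _ _).le, indepWeight_neg]
  by_cases hpos : x ∈ allPositive (N n)
  · rw [if_pos]
    · exact mul_le_of_le_one_right (indepWeight_pos _ _).le (norm_positivePhase_le _ _ _)
    · obtain ⟨ν⟩ := ‹Nonempty (Fin M)›
      exact ⟨ν, by rw [magnetisation_flip]; linarith [hpos ν]⟩
  · unfold positivePhase
    rw [if_neg hpos, norm_zero, mul_zero]
    split_ifs
    · exact (indepWeight_pos _ _).le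
    · exact le_rfl

/-! ### Asymptotics of the unnormalised Fourier transforms -/

section Main

variable {V : Type*} [NormedAddCommGroup V] [InnerProductSpace ℝ V]

/-- The delta method: a field perturbation of order `1 / √N` moves the mean by its derivative `1 -
tanh²`, and `√(N_ν / N)` contributes the factor `√α`. -/
theorem tendsto_sqrt_mul_tanh_sub {N : ℕ → Fin M → ℕ} {α : Fin M → ℝ}
    (hα : ∀ ν, Tendsto (fun n => (N n ν : ℝ) / (total (N n) : ℝ)) atTop (𝓝 (α ν)))
    (htot : Tendsto (fun n => Real.sqrt (total (N n))) atTop atTop) (y γ : ℝ) (ν : Fin M) :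
    Tendsto (fun n => Real.sqrt (N n ν) *
      (Real.tanh (y + (Real.sqrt (total (N n)))⁻¹ * γ) - Real.tanh y)) atTop
      (𝓝 (Real.sqrt (α ν) * ((1 - Real.tanh y ^ 2) * γ))) := by
  have h1 : Tendsto (fun n => Real.sqrt (total (N n)) *
      (Real.tanh (y + (Real.sqrt (total (N n)))⁻¹ * γ) - Real.tanh y)) atTop
      (𝓝 ((1 - Real.tanh y ^ 2) * γ)) := by
    rw [← tendsto_sub_nhds_zero_iff]
    refine squeeze_zero_norm' ?_
      (by simpa using (tendsto_inv_atTop_zero.comp htot).const_mul (2 * |γ| ^ 2))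
    filter_upwards [htot.eventually_gt_atTop 0] with n hn
    set s := Real.sqrt (total (N n)) with hs
    have h2 := abs_tanh_taylor_le y (s⁻¹ * γ)
    have e : s * (Real.tanh (y + s⁻¹ * γ) - Real.tanh y) - (1 - Real.tanh y ^ 2) * γ =
        s * (Real.tanh (y + s⁻¹ * γ) - Real.tanh y - s⁻¹ * γ * (1 - Real.tanh y ^ 2)) := by
      field_simp
    rw [e, Real.norm_eq_abs, abs_mul, abs_of_pos hn]
    calc _ ≤ s * (2 * |s⁻¹ * γ| ^ 2) := by gcongr
      _ = _ := by
        rw [abs_mul, abs_of_pos (inv_pos.2 hn)]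
        field_simp
  refine (((hα ν).sqrt).mul h1).congr' ?_
  filter_upwards [htot.eventually_gt_atTop 0] with n hn
  rw [Real.sqrt_div' _ (Nat.cast_nonneg _)]
  field_simp

variable [FiniteDimensional ℝ V] [MeasurableSpace V] [BorelSpace V]

/-- The asymptotics of the Fourier transforms of the unnormalised conditional laws. -/
theorem tendsto_normalised_sum [Nonempty (Fin M)] {N : ℕ → Fin M → ℕ} {α : Fin M → ℝ}
    (hN : ∀ ν, Tendsto (fun n => N n ν) atTop atTop)
    (hα : ∀ ν, Tendsto (fun n => (N n ν : ℝ) / (total (N n) : ℝ)) atTop (𝓝 (α ν)))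
    {a : Fin M → V} {J : Matrix (Fin M) (Fin M) ℝ} (hJ : ∀ l m, J l m = inner ℝ (a l) (a m))
    {w : V} (hpos : ∀ ν, 0 < (inner ℝ (a ν) w : ℝ))
    (hw : globalMinima (freeEnergy a α) = {w, -w})
    {T : V ≃L[ℝ] V} (hT : ∀ g, freeHessian a α w g = ‖T g‖ ^ 2)
    {ε : ℕ → ℝ} (hε : Tendsto ε atTop (𝓝 0))
    (hp : ∀ n v, |Real.sqrt (total (N n)) * ∑ ν, (proportion (N n) ν - α ν) *
      (Real.log (Real.cosh (inner ℝ (a ν) v)) - Real.log (Real.cosh (inner ℝ (a ν) w)))| ≤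
        ε n * ‖v - w‖) :
    ∃ D : ℕ → ℂ, ∀ t : EuclideanSpace ℝ (Fin M), ∀ u : V,
      (∀ g, (inner ℝ (T u) (T g) : ℝ) = ∑ ν, t ν * (Real.sqrt (α ν) *
        ((1 - Real.tanh (inner ℝ (a ν) w) ^ 2) * inner ℝ (a ν) g))) →
      Tendsto (fun n => D n * ∑ x : Config (N n), (Real.exp (-hamiltonian J x) : ℂ) *
        positivePhase (fun ν => Real.tanh (inner ℝ (a ν) w)) t x) atTop
      (𝓝 (Complex.exp (-((∑ ν, (1 - Real.tanh (inner ℝ (a ν) w) ^ 2) * t ν ^ 2 + ‖T u‖ ^ 2 : ℝ)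
        / 2)) * ∫ g : V, (Real.exp (-(‖T g‖ ^ 2 / 2)) : ℂ))) := by
  have htotN := tendsto_total hN
  have htot : Tendsto (fun n => Real.sqrt (total (N n))) atTop atTop :=
    Real.tendsto_sqrt_atTop.comp (tendsto_natCast_atTop_atTop.comp htotN)
  have hw0 : w ≠ 0 := by
    rintro rfl
    obtain ⟨ν⟩ := ‹Nonempty (Fin M)›
    have := hpos ν
    simp at this
  obtain ⟨c₀, hc₀, hc⟩ := exists_mul_norm_sq_le T
  have hq : ∀ g, c₀ * ‖g‖ ^ 2 ≤ freeHessian a α w g := fun g => by rw [hT]; exact hc g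
  set m : Fin M → ℝ := fun ν => Real.tanh (inner ℝ (a ν) w) with hm
  let s : ℕ → ℝ := fun n => Real.sqrt (total (N n))
  let F : ℕ → V → ℝ := fun n => freeEnergy a (proportion (N n))
  -- These prefactors undo the rescaling of the variable, the value of the free energy at `w`, the
  -- factor `2 ^ N` and the Gaussian mass. None depends on `t`, so they cancel in ratios.
  refine ⟨fun n => ((s n ^ Module.finrank ℝ V : ℝ) : ℂ) * (Real.exp (total (N n) * F n w) : ℂ) *
    (2 ^ total (N n))⁻¹ * ((∫ v : V, Real.exp (-((total (N n) : ℝ) / 2) * ‖v‖ ^ 2) : ℝ) : ℂ),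
    fun t u hu => ?_⟩
  let R : ℕ → V → ℂ := fun n => fieldExpectation a (positivePhase (N := N n) m t)
  -- The contribution of the other half space, reflected to the side of `w`.
  let R' : ℕ → V → ℂ := fun n => (openHalfSpace w).indicator fun v => R n (-v)
  have hRm : ∀ n, Measurable (R n) := fun n => (continuous_fieldExpectation a _).measurable
  have hR1 : ∀ n v, ‖R n v‖ ≤ 1 := fun n v =>
    norm_fieldExpectation_le a (norm_positivePhase_le m t) v
  have hopen : MeasurableSet (openHalfSpace w) :=
    (isOpen_lt continuous_const (continuous_id.inner continuous_const)).measurableSet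
  have hR'm : ∀ n, Measurable (R' n) := fun n => ((hRm n).comp measurable_neg).indicator hopen
  have hR'1 : ∀ n v, ‖R' n v‖ ≤ 1 := fun n v =>
    (norm_indicator_le_norm_self _ _).trans (hR1 n (-v))
  have hline : ∀ g : V, ∀ ν, Tendsto (fun n => (inner ℝ (a ν) (w + (s n)⁻¹ • g) : ℝ)) atTop
      (𝓝 (inner ℝ (a ν) w)) := by
    intro g ν
    have : Tendsto (fun n => w + (s n)⁻¹ • g) atTop (𝓝 w) := by
      simpa using ((tendsto_inv_atTop_zero.comp htot).smul_const g).const_add w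
    exact tendsto_const_nhds.inner this
  have hℓ : ∀ g, Tendsto (fun n => R n (w + (s n)⁻¹ • g)) atTop
      (𝓝 (Complex.exp ((inner ℝ (T u) (T g) : ℝ) * Complex.I -
        (∑ ν, (1 - m ν ^ 2) * t ν ^ 2 : ℝ) / 2))) := by
    intro g
    rw [hu g]
    refine tendsto_indep_positivePhase hN t hpos (hline g) fun ν => ?_
    refine (tendsto_sqrt_mul_tanh_sub hα htot (inner ℝ (a ν) w) (inner ℝ (a ν) g) ν).congr
      fun n => ?_
    rw [inner_add_right, inner_smul_right]
  have hℓ' : ∀ g, Tendsto (fun n => R' n (w + (s n)⁻¹ • g)) atTop (𝓝 0) := by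
    intro g
    have h1 : Tendsto (fun n => R n (-(w + (s n)⁻¹ • g))) atTop (𝓝 0) := by
      refine (tendsto_indep_neg_positivePhase (m := m) hN t hpos (hline g)).congr fun n => ?_
      simp only [R, fieldExpectation, inner_neg_right]
      rfl
    exact squeeze_zero_norm (fun n => norm_indicator_le_norm_self _ _) (by simpa using h1.norm)
  have L1 := tendsto_laplace hw0 hw hc₀ hq htot hε hp hRm hR1 hℓ
  -- The reflected part has the same exponential weight because the free energy is even, but its
  -- phase tends to `0`.
  have L2 := tendsto_laplace hw0 hw hc₀ hq htot hε hp hR'm hR'1 hℓ'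
  have L := L1.add L2
  simp only [mul_zero, integral_zero, add_zero, hT] at L
  have elim : ∫ g : V, (Real.exp (-(‖T g‖ ^ 2 / 2)) : ℂ) *
      Complex.exp ((inner ℝ (T u) (T g) : ℝ) * Complex.I -
        (∑ ν, (1 - m ν ^ 2) * t ν ^ 2 : ℝ) / 2) =
      Complex.exp (-((∑ ν, (1 - m ν ^ 2) * t ν ^ 2 + ‖T u‖ ^ 2 : ℝ) / 2)) *
        ∫ g : V, (Real.exp (-(‖T g‖ ^ 2 / 2)) : ℂ) := by
    simp_rw [sub_eq_add_neg, Complex.exp_add, ← mul_assoc]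
    rw [integral_mul_const, integral_gaussian_fourier, mul_right_comm, Complex.ofReal_exp,
      ← Complex.exp_add]
    congr 2
    push_cast
    ring
  rw [elim] at L
  refine L.congr' ?_
  filter_upwards [htotN.eventually_gt_atTop 0, htot.eventually_gt_atTop 0] with n hn hsn
  obtain ⟨hint, hsum⟩ := sum_exp_neg_hamiltonian_mul hJ hn (positivePhase m t)
  have hs2 : Real.sqrt (total (N n)) ^ 2 = total (N n) := Real.sq_sqrt (Nat.cast_nonneg _)
  have hF : ∀ v, (Real.exp (-(Real.sqrt (total (N n)) ^ 2 * (F n v - F n w))) : ℂ) =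
      (Real.exp (total (N n) * F n w) : ℂ) * (Real.exp (-(total (N n) * F n v)) : ℂ) := by
    intro v
    rw [hs2, ← Complex.ofReal_mul, ← Real.exp_add]
    congr 2
    ring
  have hh : Integrable fun v => (Real.exp (-(Real.sqrt (total (N n)) ^ 2 * (F n v - F n w))) : ℂ) *
      R n v := by
    simp_rw [hF, mul_assoc]
    exact hint.const_mul _
  have hsplit := integral_eq_integral_halfSpace w hh
  have e2 : ((openHalfSpace w).indicator fun v => (Real.exp (-(Real.sqrt (total (N n)) ^ 2 *
      (F n (-v) - F n w))) : ℂ) * R n (-v)) = fun v => (Real.exp (-(Real.sqrt (total (N n)) ^ 2 *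
      (F n v - F n w))) : ℂ) * R' n v := by
    funext v
    simp only [R', F, freeEnergy_neg]
    by_cases hv : v ∈ openHalfSpace w
    · rw [Set.indicator_of_mem hv, Set.indicator_of_mem hv]
    · rw [Set.indicator_of_notMem hv, Set.indicator_of_notMem hv, mul_zero]
  rw [e2] at hsplit
  rw [integral_comp_add_inv_smul w hsn, integral_comp_add_inv_smul w hsn, ← mul_add, ← hsplit]
  simp_rw [hF, mul_assoc]
  rw [integral_const_mul, hsum]
  simp only [s]
  have h2 : ((2 : ℂ) ^ total (N n)) ≠ 0 := pow_ne_zero _ two_ne_zero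
  rw [inv_mul_cancel_left₀ h2]

end Main

/-! ### From Fourier sums to conditional laws -/

instance (N : Fin M → ℕ) : DiscreteMeasurableSpace (Config N) := ⟨fun _ => trivial⟩

theorem partitionFunction_pos (J : Matrix (Fin M) (Fin M) ℝ) (N : Fin M → ℕ) :
    0 < partitionFunction J N :=
  Finset.sum_pos (fun _ _ => Real.exp_pos _) ⟨fun _ _ => 1, Finset.mem_univ _⟩

theorem gibbs_singleton (J : Matrix (Fin M) (Fin M) ℝ) (N : Fin M → ℕ) (x : Config N) :
    gibbs J N {x} = ENNReal.ofReal ((partitionFunction J N)⁻¹ * Real.exp (-hamiltonian J x)) := by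
  classical
  simp [gibbs, Measure.finsetSum_apply, Set.indicator_apply]

theorem gibbs_real_singleton (J : Matrix (Fin M) (Fin M) ℝ) (N : Fin M → ℕ) (x : Config N) :
    (gibbs J N).real {x} = (partitionFunction J N)⁻¹ * Real.exp (-hamiltonian J x) := by
  rw [measureReal_def, gibbs_singleton, ENNReal.toReal_ofReal]
  have := partitionFunction_pos J N
  positivity

instance (J : Matrix (Fin M) (Fin M) ℝ) (N : Fin M → ℕ) : IsFiniteMeasure (gibbs J N) := by
  constructor
  simp [gibbs, Measure.finsetSum_apply, ENNReal.ofReal_lt_top]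

theorem gibbs_ne_zero (J : Matrix (Fin M) (Fin M) ℝ) {N : Fin M → ℕ} {A : Set (Config N)}
    (hA : A.Nonempty) : gibbs J N A ≠ 0 := by
  obtain ⟨x, hx⟩ := hA
  refine ne_of_gt (lt_of_lt_of_le ?_ (measure_mono (Set.singleton_subset_iff.2 hx)))
  rw [gibbs_singleton, ENNReal.ofReal_pos]
  have := partitionFunction_pos J N
  positivity

open Classical in
-- Conditioning cancels the partition function and leaves a ratio of two finite sums.
theorem charFun_cond_gibbs (J : Matrix (Fin M) (Fin M) ℝ) {N : Fin M → ℕ} (A : Set (Config N))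
    (f : Config N → EuclideanSpace ℝ (Fin M)) (t : EuclideanSpace ℝ (Fin M)) :
    charFun ((cond (gibbs J N) A).map f) t =
      (∑ x, (Real.exp (-hamiltonian J x) : ℂ) *
        if x ∈ A then Complex.exp ((inner ℝ (f x) t : ℝ) * Complex.I) else 0) /
      ∑ x, (Real.exp (-hamiltonian J x) : ℂ) * if x ∈ A then 1 else 0 := by
  have hZ := (partitionFunction_pos J N).ne'
  have hA : (gibbs J N).real A = (partitionFunction J N)⁻¹ *
      ∑ x, Real.exp (-hamiltonian J x) * if x ∈ A then 1 else 0 := by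
    have h1 : A = ((Finset.univ.filter (· ∈ A) : Finset (Config N)) : Set (Config N)) := by
      ext; simp
    conv_lhs => rw [h1]
    rw [← sum_measureReal_singleton, Finset.sum_filter, Finset.mul_sum]
    refine Finset.sum_congr rfl fun x _ => ?_
    rw [gibbs_real_singleton]
    split_ifs <;> simp
  rw [charFun_apply, integral_map (by fun_prop) (by fun_prop), integral_fintype .of_finite]
  have hx : ∀ x, (cond (gibbs J N) A).real {x} = ((gibbs J N).real A)⁻¹ *
      ((partitionFunction J N)⁻¹ * (Real.exp (-hamiltonian J x) * if x ∈ A then 1 else 0)) := by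
    intro x
    rw [measureReal_def, cond_apply (MeasurableSet.of_discrete), ENNReal.toReal_mul,
      ENNReal.toReal_inv, ← measureReal_def, ← measureReal_def]
    congr 1
    split_ifs with h
    · rw [Set.inter_eq_right.2 (Set.singleton_subset_iff.2 h), gibbs_real_singleton, mul_one]
    · rw [Set.inter_singleton_eq_empty.2 h]
      simp
  simp_rw [hx, hA]
  rw [div_eq_inv_mul]
  conv_rhs => rw [Finset.mul_sum]
  refine Finset.sum_congr rfl fun x _ => ?_
  rw [Complex.real_smul]
  have hZc : (partitionFunction J N : ℂ) ≠ 0 := by exact_mod_cast hZ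
  have hc : ∀ x : Config N, ((if x ∈ A then 1 else 0 : ℝ) : ℂ) = if x ∈ A then 1 else 0 := by
    intro x
    split_ifs <;> simp
  push_cast
  simp_rw [hc]
  split_ifs
  · field_simp
  · simp

/-- Lévy's continuity theorem after a shift of the index. The shift is needed because for small `n`
the conditioning event may be null and the conditional measure zero. -/
theorem weaklyConverges_of_charFun {E : Type*} [NormedAddCommGroup E] [InnerProductSpace ℝ E]
    [FiniteDimensional ℝ E] [MeasurableSpace E] [BorelSpace E] {μ : ℕ → Measure E} {ν : Measure E}
    [IsProbabilityMeasure ν] (hμ : ∀ᶠ n in atTop, IsProbabilityMeasure (μ n))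
    (h : ∀ t, Tendsto (fun n => charFun (μ n) t) atTop (𝓝 (charFun ν t))) :
    WeaklyConverges μ ν := by
  obtain ⟨n₀, hn₀⟩ := eventually_atTop.1 hμ
  let P : ℕ → ProbabilityMeasure E := fun n => ⟨μ (n + n₀), hn₀ _ (Nat.le_add_left _ _)⟩
  have hP : Tendsto P atTop (𝓝 (⟨ν, inferInstance⟩ : ProbabilityMeasure E)) :=
    ProbabilityMeasure.tendsto_of_tendsto_charFun fun t =>
      (h t).comp (tendsto_add_atTop_nat n₀)
  intro f
  rw [← tendsto_add_atTop_iff_nat n₀]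
  exact ProbabilityMeasure.tendsto_iff_forall_integral_tendsto.1 hP f

open Classical in
-- The energy is invariant under the flip and the centred fluctuation changes sign, so the negative
-- event at `t` is the positive event at `-t`.
theorem sum_allNegative_eq (J : Matrix (Fin M) (Fin M) ℝ) {N : Fin M → ℕ} (m : Fin M → ℝ)
    (t : EuclideanSpace ℝ (Fin M)) :
    ∑ x : Config N, (Real.exp (-hamiltonian J x) : ℂ) * (if x ∈ allNegative N then
      Complex.exp ((inner ℝ (fluctuation (-m) x) t : ℝ) * Complex.I) else 0) =
    ∑ x : Config N, (Real.exp (-hamiltonian J x) : ℂ) * positivePhase m (-t) x := by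
  rw [← Equiv.sum_comp flip]
  refine Finset.sum_congr rfl fun x _ => ?_
  rw [hamiltonian_flip, fluctuation_flip, inner_neg_left, ← inner_neg_right, positivePhase]
  congr 1
  refine if_congr ?_ rfl rfl
  simp [allNegative, allPositive, magnetisation_flip]

/-- The configuration with all spins up. -/
def allUp (N : Fin M → ℕ) : Config N := fun _ _ => 1

theorem magnetisation_allUp {N : Fin M → ℕ} (ν : Fin M) : magnetisation (allUp N) ν = N ν := by
  simp [magnetisation, spin, allUp]

theorem eventually_isProbabilityMeasure {N : ℕ → Fin M → ℕ}
    (hN : ∀ ν, Tendsto (fun n => N n ν) atTop atTop) (J : Matrix (Fin M) (Fin M) ℝ)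
    (m : Fin M → ℝ) :
    ∀ᶠ n in atTop,
      IsProbabilityMeasure ((cond (gibbs J (N n)) (allPositive (N n))).map (fluctuation m)) ∧
      IsProbabilityMeasure ((cond (gibbs J (N n)) (allNegative (N n))).map (fluctuation (-m))) := by
  have hev : ∀ᶠ n in atTop, ∀ ν, 0 < N n ν :=
    eventually_all.2 fun ν => (hN ν).eventually_gt_atTop 0
  filter_upwards [hev] with n hn
  have h1 : allUp (N n) ∈ allPositive (N n) := fun ν => by
    rw [magnetisation_allUp]; exact_mod_cast hn ν
  have h2 : flip (allUp (N n)) ∈ allNegative (N n) := fun ν => by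
    rw [magnetisation_flip, magnetisation_allUp, neg_lt_zero]; exact_mod_cast hn ν
  have p1 := cond_isProbabilityMeasure (gibbs_ne_zero J ⟨_, h1⟩)
  have p2 := cond_isProbabilityMeasure (gibbs_ne_zero J ⟨_, h2⟩)
  exact ⟨Measure.isProbabilityMeasure_map (by fun_prop),
    Measure.isProbabilityMeasure_map (by fun_prop)⟩

/-- Without any groups the conditional central limit theorems are trivial. -/
theorem conditionalCLT_of_isEmpty [IsEmpty (Fin M)] (J : Matrix (Fin M) (Fin M) ℝ)
    (N : ℕ → Fin M → ℕ) (m : Fin M → ℝ) (E : Matrix (Fin M) (Fin M) ℝ) :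
    ConditionalCLT J N m E := by
  have hP := eventually_isProbabilityMeasure (N := N) (fun ν => isEmptyElim ν) J m
  have key : ∀ μ : ℕ → Measure (EuclideanSpace ℝ (Fin M)),
      (∀ᶠ n in atTop, IsProbabilityMeasure (μ n)) →
      WeaklyConverges μ (multivariateGaussian 0 E) := by
    intro μ hμ f
    have hf : ∀ z, f z = f 0 := fun z => by rw [Subsingleton.elim z 0]
    refine tendsto_const_nhds.congr' ?_
    filter_upwards [hμ] with n hn
    simp [hf]
  exact ⟨by rw [Subsingleton.elim E 1]; exact Matrix.PosSemidef.one,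
    key _ (hP.mono fun _ h => h.1), key _ (hP.mono fun _ h => h.2)⟩

/-- The conditional central limit theorems for a model with couplings `⟪a l, a m⟫` whose free energy
has exactly two minimisers, both nondegenerate. -/
theorem conditionalCLT_of_freeEnergy [Nonempty (Fin M)] {V : Type*} [NormedAddCommGroup V]
    [InnerProductSpace ℝ V] [FiniteDimensional ℝ V] [MeasurableSpace V] [BorelSpace V]
    {N : ℕ → Fin M → ℕ} {α : Fin M → ℝ}
    (hN : ∀ ν, Tendsto (fun n => N n ν) atTop atTop)
    (hα : ∀ ν, Tendsto (fun n => (N n ν : ℝ) / (total (N n) : ℝ)) atTop (𝓝 (α ν)))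
    {a : Fin M → V} {J : Matrix (Fin M) (Fin M) ℝ} (hJ : ∀ l m, J l m = inner ℝ (a l) (a m))
    {w : V} (hpos : ∀ ν, 0 < (inner ℝ (a ν) w : ℝ))
    (hw : globalMinima (freeEnergy a α) = {w, -w})
    {T : V ≃L[ℝ] V} (hT : ∀ g, freeHessian a α w g = ‖T g‖ ^ 2)
    {ε : ℕ → ℝ} (hε : Tendsto ε atTop (𝓝 0))
    (hp : ∀ n v, |Real.sqrt (total (N n)) * ∑ ν, (proportion (N n) ν - α ν) *
      (Real.log (Real.cosh (inner ℝ (a ν) v)) - Real.log (Real.cosh (inner ℝ (a ν) w)))| ≤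
        ε n * ‖v - w‖)
    {E : Matrix (Fin M) (Fin M) ℝ} (hE : E.PosSemidef)
    (hEu : ∀ t : Fin M → ℝ, ∃ u : V,
      (∀ g, (inner ℝ (T u) (T g) : ℝ) = ∑ ν, t ν * (Real.sqrt (α ν) *
        ((1 - Real.tanh (inner ℝ (a ν) w) ^ 2) * inner ℝ (a ν) g))) ∧
      t ⬝ᵥ E.mulVec t = ∑ ν, (1 - Real.tanh (inner ℝ (a ν) w) ^ 2) * t ν ^ 2 + ‖T u‖ ^ 2) :
    ConditionalCLT J N (fun ν => Real.tanh (inner ℝ (a ν) w)) E := by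
  classical
  obtain ⟨D, hD⟩ := tendsto_normalised_sum hN hα hJ hpos hw hT hε hp
  set m : Fin M → ℝ := fun ν => Real.tanh (inner ℝ (a ν) w) with hm
  obtain ⟨c₀, hc₀, hc⟩ := exists_mul_norm_sq_le T
  have hI := integral_exp_neg_norm_sq_equiv_ne_zero T hc₀ hc
  set I : ℂ := ∫ g : V, (Real.exp (-(‖T g‖ ^ 2 / 2)) : ℂ)
  have hlim : ∀ t : EuclideanSpace ℝ (Fin M), Tendsto (fun n => D n * ∑ x : Config (N n),
      (Real.exp (-hamiltonian J x) : ℂ) * positivePhase m t x) atTop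
      (𝓝 (charFun (multivariateGaussian 0 E) t * I)) := by
    intro t
    obtain ⟨u, hu, htE⟩ := hEu t
    have := hD t u hu
    rw [← htE] at this
    rw [charFun_multivariateGaussian hE]
    simpa only [inner_zero_right, Complex.ofReal_zero, zero_mul, zero_sub] using this
  have hratio : ∀ t : EuclideanSpace ℝ (Fin M), Tendsto (fun n =>
      (∑ x : Config (N n), (Real.exp (-hamiltonian J x) : ℂ) * positivePhase m t x) /
        ∑ x : Config (N n), (Real.exp (-hamiltonian J x) : ℂ) * positivePhase m 0 x) atTop
      (𝓝 (charFun (multivariateGaussian 0 E) t)) := by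
    intro t
    -- At `t = 0` the sum is the unnormalised probability of the event, so the ratio is the
    -- conditional characteristic function and both `D n` and `I` drop out.
    have h0 := hlim 0
    rw [charFun_zero, probReal_univ, Complex.ofReal_one, one_mul] at h0
    have h1 := (hlim t).div h0 hI
    rw [mul_div_cancel_right₀ _ hI] at h1
    refine h1.congr' ?_
    filter_upwards [h0.eventually_ne hI] with n hn
    simp only [Pi.div_apply]
    rw [mul_div_mul_left _ _ (left_ne_zero_of_mul hn)]
  have hP := eventually_isProbabilityMeasure hN J m
  have hzero : ∀ n, ∀ x : Config (N n), positivePhase m 0 x =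
      if x ∈ allPositive (N n) then 1 else 0 := fun n x => by simp [positivePhase]
  refine ⟨hE, weaklyConverges_of_charFun (hP.mono fun _ h => h.1) fun t => ?_,
    weaklyConverges_of_charFun (hP.mono fun _ h => h.2) fun t => ?_⟩
  · refine (hratio t).congr fun n => ?_
    simp_rw [charFun_cond_gibbs, hzero]
    rfl
  · have h1 := hratio (-t)
    have h2 : charFun (multivariateGaussian 0 E) (-t) = charFun (multivariateGaussian 0 E) t := by
      rw [charFun_multivariateGaussian hE, charFun_multivariateGaussian hE]
      simp [Matrix.mulVec_neg]
    rw [h2] at h1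
    refine h1.congr fun n => ?_
    have h3 := sum_allNegative_eq J (N := N n) m 0
    simp only [inner_zero_right, Complex.ofReal_zero, zero_mul, Complex.exp_zero, neg_zero] at h3
    rw [charFun_cond_gibbs, sum_allNegative_eq, h3]

/-! ### The variable `t = tanh y` and the limiting proportions -/

theorem hasDerivAt_artanh {t : ℝ} (ht : t ∈ Set.Ioo (-1) 1) :
    HasDerivAt Real.artanh (1 - t ^ 2)⁻¹ t := by
  have h1 : (1 + t) ≠ 0 := by linarith [ht.1]
  have h2 : (1 - t) ≠ 0 := by linarith [ht.2]
  have h3 : 1 - t ^ 2 ≠ 0 := by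
    rw [show 1 - t ^ 2 = (1 + t) * (1 - t) by ring]
    exact mul_ne_zero h1 h2
  have hd := ((((hasDerivAt_id t).const_add 1).log h1).sub
    (((hasDerivAt_id t).const_sub 1).log h2)).const_mul (1 / 2)
  have hd' : HasDerivAt (fun s => 1 / 2 * (Real.log (1 + s) - Real.log (1 - s)))
      (1 - t ^ 2)⁻¹ t := by
    convert! hd using 1
    simp only [id]
    field_simp
    ring
  refine hd'.congr_of_eventuallyEq ?_
  filter_upwards [isOpen_Ioo.mem_nhds ht] with s hs
  rw [Real.artanh_eq_half_log (Set.Ioo_subset_Icc_self hs), Real.log_div]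
  · linarith [hs.1]
  · linarith [hs.2]

theorem tanh_mem_Ioo (y : ℝ) : Real.tanh y ∈ Set.Ioo (-1) 1 :=
  ⟨Real.neg_one_lt_tanh y, Real.tanh_lt_one y⟩

theorem sum_proportion {N : Fin M → ℕ} (hN : 0 < total N) : ∑ ν, proportion N ν = 1 := by
  have h : (total N : ℝ) ≠ 0 := by exact_mod_cast hN.ne'
  simp only [proportion, ← Finset.sum_div, ← Nat.cast_sum]
  exact div_self h

theorem sum_limit_proportion [Nonempty (Fin M)] {N : ℕ → Fin M → ℕ} {α : Fin M → ℝ}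
    (hN : ∀ ν, Tendsto (fun n => N n ν) atTop atTop)
    (hα : ∀ ν, Tendsto (fun n => (N n ν : ℝ) / (total (N n) : ℝ)) atTop (𝓝 (α ν))) :
    ∑ ν, α ν = 1 := by
  have h1 := tendsto_finsetSum Finset.univ fun ν _ => hα ν
  refine tendsto_nhds_unique h1 (tendsto_const_nhds.congr' ?_)
  filter_upwards [(tendsto_total hN).eventually_gt_atTop 0] with n hn
  exact (sum_proportion hn).symm

theorem limit_proportion_nonneg {N : ℕ → Fin M → ℕ} {α : Fin M → ℝ}
    (hα : ∀ ν, Tendsto (fun n => (N n ν : ℝ) / (total (N n) : ℝ)) atTop (𝓝 (α ν))) (ν : Fin M) :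
    0 ≤ α ν :=
  ge_of_tendsto' (hα ν) fun n => by positivity

/-! ### The one-dimensional mean field equation -/

section MeanField

theorem continuous_homPotential (β : ℝ) : Continuous (homPotential β) := by
  unfold homPotential
  exact ((continuous_pow 2).div_const _).sub continuous_log_cosh

theorem hasDerivAt_homPotential (β y : ℝ) :
    HasDerivAt (homPotential β) (y / β - Real.tanh y) y := by
  have h := (((hasDerivAt_id y).pow 2).div_const (2 * β)).sub (hasDerivAt_log_cosh y)
  convert! h using 1
  simp
  ring

theorem homPotential_neg (β y : ℝ) : homPotential β (-y) = homPotential β y := by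
  simp [homPotential]

theorem homPotential_taylor_zero_le (β y : ℝ) :
    homPotential β y ≤ y ^ 2 / 2 * (1 / β - 1) + 2 * |y| ^ 3 := by
  have h := (abs_le.1 (abs_log_cosh_taylor_le 0 y)).1
  simp only [zero_add, Real.cosh_zero, Real.log_one, Real.tanh_zero, sub_zero, mul_zero] at h
  have e : homPotential β y = y ^ 2 / 2 * (1 / β) - Real.log (Real.cosh y) := by
    rw [homPotential]
    ring
  rw [e]
  linarith

theorem exists_globalMinima_homPotential {β : ℝ} (hβ : 0 < β) :
    (globalMinima (homPotential β)).Nonempty := by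
  refine (continuous_homPotential β).exists_forall_le ?_
  have h1 : Tendsto (fun r : ℝ => r * (r / (2 * β) - 1)) atTop atTop :=
    tendsto_id.atTop_mul_atTop₀ (tendsto_atTop_add_const_right _ (-1)
      (tendsto_id.atTop_div_const (by positivity)))
  refine tendsto_atTop_mono (fun y => ?_) (h1.comp (tendsto_norm_cocompact_atTop (E := ℝ)))
  have h2 := log_cosh_le_abs y
  simp only [Function.comp, homPotential, Real.norm_eq_abs]
  rw [← sq_abs y]
  have : |y| * (|y| / (2 * β) - 1) = |y| ^ 2 / (2 * β) - |y| := by ring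
  linarith

theorem eq_mul_tanh_of_mem_globalMinima {β y : ℝ} (hβ : 0 < β)
    (hy : y ∈ globalMinima (homPotential β)) : y = β * Real.tanh y := by
  have hmin : IsLocalMin (homPotential β) y := Eventually.of_forall hy
  have h := hmin.hasDerivAt_eq_zero (hasDerivAt_homPotential β y)
  field_simp at h
  linarith

/-- Both solutions have the same value `1 / β` of the strictly decreasing function `tanh y / y`. -/
theorem eq_of_eq_mul_tanh {β y z : ℝ} (hy : 0 < y) (hz : 0 < z) (hy' : y = β * Real.tanh y)
    (hz' : z = β * Real.tanh z) : y = z := by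
  have key : ∀ a b : ℝ, 0 < a → a = β * Real.tanh a → b = β * Real.tanh b → ¬ a < b := by
    intro a b ha ha' hb' hab
    have h := mul_tanh_lt_mul_tanh ha hab
    have h1 := tanh_pos ha
    have hβ : 0 < β := by
      by_contra hβ
      have : β * Real.tanh a ≤ 0 := mul_nonpos_of_nonpos_of_nonneg (not_lt.1 hβ) h1.le
      linarith
    have h2 : β * (a * Real.tanh b) < β * (b * Real.tanh a) := mul_lt_mul_of_pos_left h hβ
    have h3 : β * (a * Real.tanh b) = a * b := by rw [mul_left_comm, ← hb']
    have h4 : β * (b * Real.tanh a) = b * a := by rw [mul_left_comm, ← ha']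
    linarith [mul_comm a b]
  exact le_antisymm (not_lt.1 (key z y hz hz' hy')) (not_lt.1 (key y z hy hy' hz'))

theorem zero_notMem_globalMinima_homPotential {β : ℝ} (hβ : 1 < β) :
    (0 : ℝ) ∉ globalMinima (homPotential β) := by
  intro h
  set κ := 1 - 1 / β with hκ
  have hκ0 : 0 < κ := by
    rw [hκ, sub_pos, div_lt_one (by linarith)]
    exact hβ
  -- At `y = κ / 8` the Taylor bound is `-κ³ / 128 + κ³ / 256 < 0`, below the value at `0`.
  have h1 := h (κ / 8)
  have h2 := homPotential_taylor_zero_le β (κ / 8)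
  rw [abs_of_pos (by positivity)] at h2
  have h0 : homPotential β 0 = 0 := by simp [homPotential]
  rw [h0] at h1
  have h3 : (1 / β - 1) = -κ := by rw [hκ]; ring
  rw [h3] at h2
  have h4 : 0 < κ ^ 3 := by positivity
  nlinarith

/-- The mean field equation `y = β tanh y` at low temperature. -/
theorem exists_globalMinima_homPotential_eq {β : ℝ} (hβ : 1 < β) :
    ∃ x, 0 < x ∧ x = β * Real.tanh x ∧ globalMinima (homPotential β) = {x, -x} := by
  have hβ0 : 0 < β := by linarith
  have hneg : ∀ y, y ∈ globalMinima (homPotential β) → -y ∈ globalMinima (homPotential β) :=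
    fun y hy z => by rw [homPotential_neg]; exact hy z
  have habs : ∀ y, y ∈ globalMinima (homPotential β) →
      0 < |y| ∧ |y| ∈ globalMinima (homPotential β) := by
    intro y hy
    refine ⟨abs_pos.2 fun h0 => zero_notMem_globalMinima_homPotential hβ (h0 ▸ hy), ?_⟩
    rcases abs_choice y with h | h <;> rw [h]
    exacts [hy, hneg y hy]
  obtain ⟨y, hy⟩ := exists_globalMinima_homPotential hβ0
  obtain ⟨hx0, hx⟩ := habs y hy
  refine ⟨|y|, hx0, eq_mul_tanh_of_mem_globalMinima hβ0 hx, ?_⟩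
  ext z
  constructor
  · intro hz
    obtain ⟨hz0, hz'⟩ := habs z hz
    have := eq_of_eq_mul_tanh hz0 hx0 (eq_mul_tanh_of_mem_globalMinima hβ0 hz')
      (eq_mul_tanh_of_mem_globalMinima hβ0 hx)
    rw [← this]
    rcases abs_choice z with h | h <;> simp [h]
  · rintro (rfl | rfl)
    exacts [hx, hneg _ hx]

theorem isGreatest_tanh {β x : ℝ} (hβ : 1 < β) (hx : 0 < x) (hx' : x = β * Real.tanh x) :
    IsGreatest {u : ℝ | Real.tanh (β * u) = u} (Real.tanh x) := by
  refine ⟨by change Real.tanh (β * Real.tanh x) = _; rw [← hx'], fun u hu => ?_⟩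
  have hu' : Real.tanh (β * u) = u := hu
  by_contra hlt
  push Not at hlt
  have hu0 : 0 < u := (tanh_pos hx).trans hlt
  have h := eq_of_eq_mul_tanh (mul_pos (by linarith) hu0) hx (by rw [hu'] : β * u = _) hx'
  rw [h] at hu'
  exact hlt.ne hu'

theorem hasDerivAt_homPotentialTilde (β m : ℝ) {t : ℝ} (ht : t ∈ Set.Ioo (-1) 1) :
    HasDerivAt (homPotentialTilde β m) ((Real.artanh t / β - t) * (1 - t ^ 2)⁻¹) t := by
  have h := ((hasDerivAt_homPotential β (Real.artanh t)).comp t (hasDerivAt_artanh ht)).sub_const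
    (homPotential β (Real.artanh m))
  rw [Real.tanh_artanh ht] at h
  exact h

/-- The first derivative is a product whose first factor vanishes at the critical point, so only the
derivative of that factor contributes. -/
theorem deriv_deriv_homPotentialTilde (β m : ℝ) {t : ℝ} (ht : t ∈ Set.Ioo (-1) 1)
    (hcrit : Real.artanh t / β = t) :
    deriv (deriv (homPotentialTilde β m)) t =
      ((1 - t ^ 2)⁻¹) ^ 2 * (1 / β - (1 - t ^ 2)) := by
  have hne : 1 - t ^ 2 ≠ 0 := by nlinarith [ht.1, ht.2]
  have he : deriv (homPotentialTilde β m) =ᶠ[𝓝 t]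
      fun s => (Real.artanh s / β - s) * (1 - s ^ 2)⁻¹ := by
    filter_upwards [isOpen_Ioo.mem_nhds ht] with s hs
    exact (hasDerivAt_homPotentialTilde β m hs).deriv
  rw [he.deriv_eq]
  have h1 := ((hasDerivAt_artanh ht).div_const β).sub (hasDerivAt_id t)
  have h2 := (((hasDerivAt_id t).pow 2).const_sub 1).inv hne
  have h3 := (h1.mul h2).deriv
  simp only [Pi.sub_apply, Pi.pow_apply, id] at h3
  refine (Eq.trans ?_ h3).trans ?_
  · rfl
  · simp only [Pi.inv_apply, hcrit]
    field_simp
    ring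

end MeanField

/-! ### The covariance matrix and homogeneous coupling -/

theorem dotProduct_covariance_mulVec (α m : Fin M → ℝ) (S : Matrix (Fin M) (Fin M) ℝ)
    (t : Fin M → ℝ) :
    t ⬝ᵥ (covariance α m S).mulVec t = ∑ ν, (1 - m ν ^ 2) * t ν ^ 2 +
      (fun ν => Real.sqrt (α ν) * t ν) ⬝ᵥ S.mulVec fun ν => Real.sqrt (α ν) * t ν := by
  have h1 : (Matrix.diagonal fun l => Real.sqrt (α l)).mulVec t =
      fun ν => Real.sqrt (α ν) * t ν := by
    ext ν
    rw [Matrix.mulVec_diagonal]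
  have h2 : Matrix.vecMul t (Matrix.diagonal fun l => Real.sqrt (α l)) =
      fun ν => Real.sqrt (α ν) * t ν := by
    ext ν
    rw [Matrix.vecMul_diagonal, mul_comm]
  rw [covariance, Matrix.add_mulVec, dotProduct_add, ← Matrix.mulVec_mulVec, ← Matrix.mulVec_mulVec,
    h1, Matrix.dotProduct_mulVec t (Matrix.diagonal fun l => Real.sqrt (α l)), h2]
  congr 1
  simp only [dotProduct, Matrix.mulVec_diagonal]
  exact Finset.sum_congr rfl fun ν _ => by ring

theorem posSemidef_covariance (α : Fin M → ℝ) {m : Fin M → ℝ} (hm : ∀ ν, m ν ^ 2 ≤ 1)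
    {S : Matrix (Fin M) (Fin M) ℝ} (hS : S.PosSemidef) : (covariance α m S).PosSemidef := by
  refine Matrix.PosSemidef.add (Matrix.PosSemidef.diagonal fun ν => sub_nonneg.2 (hm ν)) ?_
  have := hS.mul_mul_conjTranspose_same (Matrix.diagonal fun l => Real.sqrt (α l))
  rwa [Matrix.diagonal_conjTranspose, star_trivial] at this

theorem posSemidef_const {c : ℝ} (hc : 0 ≤ c) :
    (Matrix.of fun _ _ => c : Matrix (Fin M) (Fin M) ℝ).PosSemidef := by
  have h := (Matrix.posSemidef_vecMulVec_self_star fun _ : Fin M => Real.sqrt c)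
  convert! h using 1
  ext i j
  simp [Matrix.vecMulVec_apply, Real.mul_self_sqrt hc]

theorem dotProduct_const_mulVec (c : ℝ) (t : Fin M → ℝ) :
    t ⬝ᵥ (Matrix.of fun _ _ => c : Matrix (Fin M) (Fin M) ℝ).mulVec t = c * (∑ ν, t ν) ^ 2 := by
  simp only [dotProduct, Matrix.mulVec, Matrix.of_apply, ← Finset.mul_sum, ← Finset.sum_mul]
  ring

/-- All fields coincide, so the proportions enter only through their sum `1`. -/
theorem freeEnergy_const {α : Fin M → ℝ} (hα : ∑ ν, α ν = 1) {β : ℝ} (hβ : 0 < β) (v : ℝ) :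
    freeEnergy (fun _ : Fin M => Real.sqrt β) α v = homPotential β (Real.sqrt β * v) := by
  rw [freeEnergy, homPotential, ← Finset.sum_mul, hα, mul_pow, Real.sq_sqrt hβ.le]
  simp only [Real.norm_eq_abs, sq_abs, inner, one_mul]
  rw [mul_comm v]
  congr 1
  field_simp

/-- The conditional central limit theorem for homogeneous coupling. -/
theorem homogeneousFluctuations {N : ℕ → Fin M → ℕ} {α : Fin M → ℝ}
    (hN : ∀ ν, Tendsto (fun n => N n ν) atTop atTop)
    (hα : ∀ ν, Tendsto (fun n => (N n ν : ℝ) / (total (N n) : ℝ)) atTop (𝓝 (α ν)))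
    {β x : ℝ} (hβ : 1 < β) (hx : 0 < x) (hx' : x = β * Real.tanh x)
    (hmin : globalMinima (homPotential β) = {x, -x}) : HomogeneousFluctuations β α N x := by
  have hβ0 : 0 < β := by linarith
  set m := Real.tanh x with hm
  have hmI : m ∈ Set.Ioo (-1) 1 := tanh_mem_Ioo x
  have hmI' : -m ∈ Set.Ioo (-1 : ℝ) 1 := ⟨by linarith [hmI.2], by linarith [hmI.1]⟩
  have hd0 : 0 < 1 - m ^ 2 := one_sub_tanh_sq_pos x
  have hxm : x / β = m := by rw [div_eq_iff hβ0.ne', mul_comm]; exact hx'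
  have hh : deriv (deriv (homPotentialTilde β m)) m =
      ((1 - m ^ 2)⁻¹) ^ 2 * (1 / β - (1 - m ^ 2)) :=
    deriv_deriv_homPotentialTilde β m hmI (by rw [hm, Real.artanh_tanh, ← hm, hxm])
  have hh' : deriv (deriv (homPotentialTilde β m)) (-m) =
      ((1 - m ^ 2)⁻¹) ^ 2 * (1 / β - (1 - m ^ 2)) := by
    rw [deriv_deriv_homPotentialTilde β m hmI', neg_sq]
    rw [hm, ← Real.tanh_neg, Real.artanh_tanh, Real.tanh_neg, ← hm, neg_div, hxm]
  -- Since `m = x / β`, this is `x (1 - m²) < m` divided by `x`.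
  have hκ : 0 < 1 / β - (1 - m ^ 2) := by
    have h1 := mul_one_sub_tanh_sq_lt hx
    rw [← hm, ← hxm] at h1
    have h2 : x * (1 / β - (1 - m ^ 2)) > 0 := by
      have : x * (1 / β) = x / β := by ring
      rw [mul_sub, this]
      rw [← hxm]
      linarith
    exact pos_of_mul_pos_right h2 hx.le
  have hpos : 0 < ((1 - m ^ 2)⁻¹) ^ 2 * (1 / β - (1 - m ^ 2)) := by positivity
  refine ⟨by rw [hh]; exact hpos, by rw [hh, hh'], ?_⟩
  rw [← hm, hh]
  rcases isEmpty_or_nonempty (Fin M) with hM | hM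
  · exact conditionalCLT_of_isEmpty _ _ _ _
  have hsum := sum_limit_proportion hN hα
  -- The second derivative of the free energy in the rescaled variable `v = y / √β`; hence `T` is
  -- multiplication by `√κ`.
  set κ := β * (1 / β - (1 - m ^ 2)) with hκdef
  have hκ0 : 0 < κ := mul_pos hβ0 hκ
  have hκ' : κ = 1 - β * (1 - m ^ 2) := by rw [hκdef]; field_simp
  have hb : 0 < Real.sqrt β := Real.sqrt_pos.2 hβ0
  have hb2 : Real.sqrt β ^ 2 = β := Real.sq_sqrt hβ0.le
  set w := (Real.sqrt β)⁻¹ * x with hw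
  have hin : ∀ v : ℝ, (inner ℝ (Real.sqrt β) v : ℝ) = Real.sqrt β * v := fun v => mul_comm _ _
  have hwx : Real.sqrt β * w = x := by rw [hw]; field_simp
  have hinw : (inner ℝ (Real.sqrt β) w : ℝ) = x := by rw [hin, hwx]
  have hk : Real.sqrt κ ≠ 0 := (Real.sqrt_pos.2 hκ0).ne'
  have hk2 : Real.sqrt κ ^ 2 = κ := Real.sq_sqrt hκ0.le
  let T : ℝ ≃L[ℝ] ℝ := (LinearEquiv.smulOfNeZero ℝ ℝ (Real.sqrt κ) hk).toContinuousLinearEquiv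
  have hTg : ∀ g, T g = Real.sqrt κ * g := fun g => rfl
  have hmin' : globalMinima (freeEnergy (fun _ : Fin M => Real.sqrt β) α) = {w, -w} := by
    have h1 : ∀ v, v ∈ globalMinima (freeEnergy (fun _ : Fin M => Real.sqrt β) α) ↔
        Real.sqrt β * v ∈ globalMinima (homPotential β) := by
      intro v
      constructor
      · intro hv z
        have := hv ((Real.sqrt β)⁻¹ * z)
        rwa [freeEnergy_const hsum hβ0, freeEnergy_const hsum hβ0,
          mul_inv_cancel_left₀ hb.ne'] at this
      · intro hv z
        rw [freeEnergy_const hsum hβ0, freeEnergy_const hsum hβ0]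
        exact hv _
    ext v
    rw [h1, hmin]
    simp only [Set.mem_insert_iff, Set.mem_singleton_iff]
    rw [← hwx, ← mul_neg, mul_right_inj' hb.ne', mul_right_inj' hb.ne']
  have main := conditionalCLT_of_freeEnergy (V := ℝ) (J := Matrix.of fun _ _ => β) (T := T)
    (a := fun _ : Fin M => Real.sqrt β) (w := w) (ε := fun _ => 0)
    (E := covariance α (fun _ => m)
      (Matrix.of fun _ _ => (((1 - m ^ 2)⁻¹) ^ 2 * (1 / β - (1 - m ^ 2)))⁻¹)) hN hα
    (fun l k => by rw [hin, ← pow_two, hb2]; rfl) (fun ν => by rw [hinw]; exact hx) hmin'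
    (fun g => by
      simp only [freeHessian, hinw, hin, ← hm, hTg, norm_mul, mul_pow, Real.norm_eq_abs, sq_abs,
        hk2, hb2, ← Finset.sum_mul, hsum]
      rw [hκ']
      ring)
    tendsto_const_nhds
    -- The increments of `log cosh` are the same for all groups and both families of proportions sum
    -- to `1`, so the error is exactly zero. If there are no spins, the square root vanishes.
    (fun n v => by
      simp only [hin, ← Finset.sum_mul, Finset.sum_sub_distrib, hsum]
      rcases Nat.eq_zero_or_pos (total (N n)) with h0 | h0
      · simp [h0]
      · simp [sum_proportion h0])
    (posSemidef_covariance α (fun _ => by linarith) (posSemidef_const (inv_pos.2 hpos).le))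
    (fun t => by
      -- The solution of `κ u g = (∑ ν, √α_ν t_ν) (1 - m²) √β g` for all `g`.
      refine ⟨(1 - m ^ 2) * Real.sqrt β * (∑ ν, Real.sqrt (α ν) * t ν) / κ, fun g => ?_, ?_⟩
      · simp only [hTg, hinw, hin, ← hm]
        have e : ∑ ν, t ν * (Real.sqrt (α ν) * ((1 - m ^ 2) * (Real.sqrt β * g))) =
            (∑ ν, Real.sqrt (α ν) * t ν) * ((1 - m ^ 2) * (Real.sqrt β * g)) := by
          rw [Finset.sum_mul]
          exact Finset.sum_congr rfl fun ν _ => by ring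
        rw [e]
        have e2 : ∀ A : ℝ, (inner ℝ (Real.sqrt κ * A) (Real.sqrt κ * g) : ℝ) = κ * g * A := by
          intro A
          rw [show (inner ℝ (Real.sqrt κ * A) (Real.sqrt κ * g) : ℝ) =
            Real.sqrt κ * g * (Real.sqrt κ * A) from rfl]
          linear_combination g * A * hk2
        rw [e2]
        field_simp
      · rw [dotProduct_covariance_mulVec, dotProduct_const_mulVec]
        simp only [hTg, hinw, ← hm, norm_mul, Real.norm_eq_abs, mul_pow, sq_abs, hk2]
        congr 1
        rw [div_pow, mul_pow, mul_pow, hb2, hκdef]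
        field_simp)
  simpa only [hinw, ← hm] using main

/-! ### The Hessian in the variables `y` and `t = tanh y` -/

section Hessian

/-- The matrix of second derivatives of the potential at `y`. -/
def potentialHessian (J : Matrix (Fin M) (Fin M) ℝ) (α y : Fin M → ℝ) : Matrix (Fin M) (Fin M) ℝ :=
  J⁻¹ - Matrix.diagonal fun l => α l * (1 - Real.tanh (y l) ^ 2)

theorem potentialHessian_neg (J : Matrix (Fin M) (Fin M) ℝ) (α y : Fin M → ℝ) :
    potentialHessian J α (-y) = potentialHessian J α y := by
  simp [potentialHessian]

theorem hasFDerivAt_potential {J : Matrix (Fin M) (Fin M) ℝ} (hJ : J⁻¹.IsSymm) (α y : Fin M → ℝ) :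
    HasFDerivAt (potential J α) (∑ l, (J⁻¹.mulVec y l - α l * Real.tanh (y l)) •
      (ContinuousLinearMap.proj l : (Fin M → ℝ) →L[ℝ] ℝ)) y := by
  have h1 : ∀ l, HasFDerivAt (fun y : Fin M → ℝ => y l)
      (ContinuousLinearMap.proj l : (Fin M → ℝ) →L[ℝ] ℝ) y := fun l => hasFDerivAt_apply l y
  have h2 : ∀ l, HasFDerivAt (fun y : Fin M → ℝ => J⁻¹.mulVec y l)
      ((ContinuousLinearMap.proj l : (Fin M → ℝ) →L[ℝ] ℝ).comp
        J⁻¹.mulVecLin.toContinuousLinearMap) y := fun l =>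
    ((ContinuousLinearMap.proj l : (Fin M → ℝ) →L[ℝ] ℝ).comp
        J⁻¹.mulVecLin.toContinuousLinearMap).hasFDerivAt
  have h3 := (HasFDerivAt.fun_sum fun l (_ : l ∈ Finset.univ) => (h1 l).mul (h2 l)).const_mul
    (1 / 2 : ℝ)
  have h4 := HasFDerivAt.fun_sum fun l (_ : l ∈ Finset.univ) =>
    ((hasDerivAt_log_cosh (y l)).comp_hasFDerivAt y (h1 l)).const_mul (α l)
  refine (h3.sub h4).congr_fderiv (ContinuousLinearMap.ext fun v => ?_)
  have hs : ∑ l, y l * J⁻¹.mulVec v l = ∑ l, J⁻¹.mulVec y l * v l := by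
    change y ⬝ᵥ J⁻¹.mulVec v = J⁻¹.mulVec y ⬝ᵥ v
    rw [Matrix.dotProduct_mulVec, ← Matrix.mulVec_transpose, hJ.eq]
  simp only [sub_apply, smul_apply,
    sum_apply, add_apply, ContinuousLinearMap.comp_apply,
    ContinuousLinearMap.proj_apply, smul_eq_mul, LinearMap.coe_toContinuousLinearMap',
    Matrix.mulVecLin_apply, Finset.sum_add_distrib, sub_mul, Finset.sum_sub_distrib, hs]
  simp only [mul_assoc]
  ring

theorem hasFDerivAt_artanh_comp {t : Fin M → ℝ} (ht : ∀ l, t l ∈ Set.Ioo (-1) 1) :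
    HasFDerivAt (fun (s : Fin M → ℝ) l => Real.artanh (s l))
      (ContinuousLinearMap.pi fun l => (1 - t l ^ 2)⁻¹ •
        (ContinuousLinearMap.proj l : (Fin M → ℝ) →L[ℝ] ℝ)) t :=
  hasFDerivAt_pi.2 fun l => HasDerivAt.comp_hasFDerivAt (h₂ := Real.artanh)
    (f := fun s : Fin M → ℝ => s l) t (hasDerivAt_artanh (ht l)) (hasFDerivAt_apply l t)

theorem hasFDerivAt_potentialTilde {J : Matrix (Fin M) (Fin M) ℝ} (hJ : J⁻¹.IsSymm)
    (α m : Fin M → ℝ) {t : Fin M → ℝ} (ht : ∀ l, t l ∈ Set.Ioo (-1) 1) :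
    HasFDerivAt (potentialTilde J α m) (∑ l, ((J⁻¹.mulVec (fun k => Real.artanh (t k)) l -
      α l * t l) * (1 - t l ^ 2)⁻¹) • (ContinuousLinearMap.proj l : (Fin M → ℝ) →L[ℝ] ℝ)) t := by
  have h := ((hasFDerivAt_potential hJ α fun l => Real.artanh (t l)).comp t
    (hasFDerivAt_artanh_comp ht)).sub_const (potentialHat J α m)
  refine h.congr_fderiv (ContinuousLinearMap.ext fun v => ?_)
  simp [Real.tanh_artanh (ht _), mul_assoc]

/-- At a critical point the second derivatives of the coordinate change are multiplied by the
vanishing gradient. Only conjugation by its Jacobian remains, and this is diagonal because `artanh`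
acts coordinatewise. -/
theorem hessian_potentialTilde {J : Matrix (Fin M) (Fin M) ℝ} (hJ : J⁻¹.IsSymm)
    (α m : Fin M → ℝ) {y : Fin M → ℝ}
    (hy : ∀ l, J⁻¹.mulVec y l = α l * Real.tanh (y l)) :
    hessian (potentialTilde J α m) (fun l => Real.tanh (y l)) =
      Matrix.diagonal (fun l => (1 - Real.tanh (y l) ^ 2)⁻¹) * potentialHessian J α y *
        Matrix.diagonal (fun l => (1 - Real.tanh (y l) ^ 2)⁻¹) := by
  set t : Fin M → ℝ := fun l => Real.tanh (y l) with ht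
  have htI : ∀ l, t l ∈ Set.Ioo (-1) 1 := fun l => tanh_mem_Ioo (y l)
  have hne : ∀ l, 1 - t l ^ 2 ≠ 0 := fun l => (one_sub_tanh_sq_pos (y l)).ne'
  have hat : (fun k => Real.artanh (t k)) = y := by
    ext k
    exact Real.artanh_tanh _
  have hev : fderiv ℝ (potentialTilde J α m) =ᶠ[𝓝 t] fun s => ∑ l,
      ((J⁻¹.mulVec (fun k => Real.artanh (s k)) l - α l * s l) * (1 - s l ^ 2)⁻¹) •
        (ContinuousLinearMap.proj l : (Fin M → ℝ) →L[ℝ] ℝ) := by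
    have : ∀ᶠ s in 𝓝 t, ∀ l, s l ∈ Set.Ioo (-1 : ℝ) 1 := eventually_all.2 fun l =>
      (continuous_apply l).continuousAt.eventually (isOpen_Ioo.mem_nhds (htI l))
    filter_upwards [this] with s hs
    exact (hasFDerivAt_potentialTilde hJ α m hs).fderiv
  let P : Fin M → (Fin M → ℝ) →L[ℝ] ℝ := fun l =>
    (ContinuousLinearMap.proj l).comp (J⁻¹.mulVecLin.toContinuousLinearMap.comp
      (ContinuousLinearMap.pi fun k => (1 - t k ^ 2)⁻¹ • ContinuousLinearMap.proj k)) -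
      α l • ContinuousLinearMap.proj l
  have hP : ∀ l, HasFDerivAt (fun s : Fin M → ℝ => J⁻¹.mulVec (fun k => Real.artanh (s k)) l -
      α l * s l) (P l) t := fun l =>
    ((((ContinuousLinearMap.proj l : (Fin M → ℝ) →L[ℝ] ℝ).comp
      J⁻¹.mulVecLin.toContinuousLinearMap).hasFDerivAt).comp t
        (hasFDerivAt_artanh_comp htI)).sub ((hasFDerivAt_apply l t).const_mul (α l))
  have hdiff : ∀ l, DifferentiableAt ℝ (fun s : Fin M → ℝ => (1 - s l ^ 2)⁻¹) t := fun l =>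
    DifferentiableAt.inv (by fun_prop) (hne l)
  have hG := HasFDerivAt.fun_sum fun l (_ : l ∈ Finset.univ) =>
    ((hP l).mul (hdiff l).hasFDerivAt).smul_const
      (ContinuousLinearMap.proj l : (Fin M → ℝ) →L[ℝ] ℝ)
  have hsecond := hev.fderiv_eq.trans hG.fderiv
  ext l k
  rw [hessian, Matrix.of_apply, hsecond]
  have hz : ∀ l, J⁻¹.mulVec y l - α l * t l = 0 := fun l => by rw [hy l, sub_self]
  have hpi : (fun i => (1 - t i ^ 2)⁻¹ * (Pi.single l (1 : ℝ) : Fin M → ℝ) i) =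
      Pi.single l ((1 - t l ^ 2)⁻¹) := by
    ext i
    by_cases h : i = l
    · subst h; simp
    · simp [h]
  simp only [hat, hz, zero_smul, zero_add, sum_apply,
    ContinuousLinearMap.smulRight_apply, smul_apply, smul_eq_mul,
    ContinuousLinearMap.proj_apply]
  rw [Finset.sum_eq_single k (fun j _ hj => by simp [hj]) (by simp)]
  have hPk : P k (Pi.single l 1) = J⁻¹ l k * (1 - t l ^ 2)⁻¹ -
      α k * (Pi.single l (1 : ℝ) : Fin M → ℝ) k := by
    change J⁻¹.mulVec (fun i => (1 - t i ^ 2)⁻¹ * (Pi.single l (1 : ℝ) : Fin M → ℝ) i) k -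
      α k * (Pi.single l (1 : ℝ) : Fin M → ℝ) k = _
    have hsymm : J⁻¹ k l = J⁻¹ l k := hJ.apply l k
    rw [hpi, Matrix.mulVec_single]
    simp [hsymm]
  rw [hPk, Matrix.mul_diagonal, Matrix.diagonal_mul, potentialHessian, Matrix.sub_apply,
    Matrix.diagonal_apply, Pi.single_eq_same, mul_one]
  have hne' := hne l
  by_cases h : k = l
  · subst h
    rw [if_pos rfl, Pi.single_eq_same]
    change _ = (1 - t k ^ 2)⁻¹ * (J⁻¹ k k - α k * (1 - t k ^ 2)) * (1 - t k ^ 2)⁻¹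
    field_simp
  · rw [if_neg (Ne.symm h), Pi.single_eq_of_ne h]
    ring

end Hessian

/-! ### Gram vectors of a positive definite coupling -/

open scoped MatrixOrder in
theorem exists_eq_transpose_mul_self {A : Matrix (Fin M) (Fin M) ℝ} (hA : A.PosSemidef) :
    ∃ C : Matrix (Fin M) (Fin M) ℝ, A = C.transpose * C := by
  obtain ⟨C, hC⟩ := CStarAlgebra.nonneg_iff_eq_star_mul_self.mp hA.nonneg
  exact ⟨C, by rw [hC, Matrix.star_eq_conjTranspose, Matrix.conjTranspose_eq_transpose_of_trivial]⟩

/-- The rows of a matrix as vectors of the Euclidean space. -/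
def rowVector (B : Matrix (Fin M) (Fin M) ℝ) (l : Fin M) : EuclideanSpace ℝ (Fin M) :=
  WithLp.toLp 2 fun k => B l k

theorem inner_rowVector (B : Matrix (Fin M) (Fin M) ℝ) (l : Fin M)
    (v : EuclideanSpace ℝ (Fin M)) : (inner ℝ (rowVector B l) v : ℝ) = B.mulVec v l := by
  simp [rowVector, EuclideanSpace.inner_eq_star_dotProduct, Matrix.mulVec, dotProduct_comm]

theorem inner_rowVector_rowVector (B : Matrix (Fin M) (Fin M) ℝ) (l k : Fin M) :
    (inner ℝ (rowVector B l) (rowVector B k) : ℝ) = (B * B.transpose) l k := by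
  rw [inner_rowVector, Matrix.mul_apply]
  rfl

section Factorisation

variable {J B : Matrix (Fin M) (Fin M) ℝ}

/-- As `J⁻¹ = B⁻ᵀ B⁻¹`, the map `B` is an isometry from the Euclidean form to the form of `J⁻¹`.
This identifies `freeEnergy` for the rows of `B` with `potential`. -/
theorem mulVec_dotProduct_inv_mulVec (hJ : J = B * B.transpose) (hB : IsUnit B.det)
    (v g : Fin M → ℝ) : B.mulVec v ⬝ᵥ J⁻¹.mulVec (B.mulVec g) = v ⬝ᵥ g := by
  have hBt : IsUnit B.transpose.det := by rwa [Matrix.det_transpose]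
  rw [hJ, Matrix.mul_inv_rev, Matrix.mulVec_mulVec, Matrix.nonsing_inv_mul_cancel_right _ _ hB,
    Matrix.dotProduct_mulVec, ← Matrix.mulVec_transpose, Matrix.mulVec_mulVec,
    Matrix.transpose_nonsing_inv, Matrix.transpose_transpose, Matrix.nonsing_inv_mul _ hB,
    Matrix.one_mulVec]

theorem norm_sq_eq_dotProduct (v : EuclideanSpace ℝ (Fin M)) :
    ‖v‖ ^ 2 = v.ofLp ⬝ᵥ v.ofLp := by
  rw [← real_inner_self_eq_norm_sq, EuclideanSpace.inner_eq_star_dotProduct, star_trivial]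

theorem freeEnergy_rowVector (hJ : J = B * B.transpose) (hB : IsUnit B.det) (α : Fin M → ℝ)
    (v : EuclideanSpace ℝ (Fin M)) :
    freeEnergy (rowVector B) α v = potential J α (B.mulVec v) := by
  simp only [freeEnergy, potential, inner_rowVector, mulVec_dotProduct_inv_mulVec hJ hB,
    norm_sq_eq_dotProduct]
  ring

theorem freeHessian_rowVector (hJ : J = B * B.transpose) (hB : IsUnit B.det) (α : Fin M → ℝ)
    (w g : EuclideanSpace ℝ (Fin M)) :
    freeHessian (rowVector B) α w g =
      B.mulVec g ⬝ᵥ (potentialHessian J α (B.mulVec w)).mulVec (B.mulVec g) := by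
  simp only [freeHessian, inner_rowVector, norm_sq_eq_dotProduct, potentialHessian,
    Matrix.sub_mulVec, dotProduct_sub, mulVec_dotProduct_inv_mulVec hJ hB]
  congr 1
  simp only [dotProduct, Matrix.mulVec_diagonal]
  exact Finset.sum_congr rfl fun l _ => by ring

theorem mem_globalMinima_freeEnergy_iff (hJ : J = B * B.transpose) (hB : IsUnit B.det)
    (α : Fin M → ℝ) (v : EuclideanSpace ℝ (Fin M)) :
    v ∈ globalMinima (freeEnergy (rowVector B) α) ↔
      B.mulVec v ∈ globalMinima (potential J α) := by
  constructor
  · intro hv z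
    have := hv (WithLp.toLp 2 (B⁻¹.mulVec z))
    rwa [freeEnergy_rowVector hJ hB, freeEnergy_rowVector hJ hB, Matrix.mulVec_mulVec,
      Matrix.mul_nonsing_inv _ hB, Matrix.one_mulVec] at this
  · intro hv z
    rw [freeEnergy_rowVector hJ hB, freeEnergy_rowVector hJ hB]
    exact hv _

end Factorisation

/-! ### Minimisers of the potential -/

section Minimisers

variable {J : Matrix (Fin M) (Fin M) ℝ}

theorem exists_factorisation (hJ : J.PosDef) :
    ∃ B : Matrix (Fin M) (Fin M) ℝ, J = B * B.transpose ∧ IsUnit B.det := by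
  obtain ⟨C, hC⟩ := exists_eq_transpose_mul_self hJ.posSemidef
  refine ⟨C.transpose, by rw [Matrix.transpose_transpose, hC], ?_⟩
  have h := (Matrix.isUnit_iff_isUnit_det _).1 hJ.isUnit
  rw [hC, Matrix.det_mul] at h
  exact isUnit_of_mul_isUnit_left h

theorem exists_preimage {B : Matrix (Fin M) (Fin M) ℝ} (hB : IsUnit B.det) (y : Fin M → ℝ) :
    ∃ w : EuclideanSpace ℝ (Fin M), B.mulVec w = y :=
  ⟨WithLp.toLp 2 (B⁻¹.mulVec y), by
    rw [Matrix.mulVec_mulVec, Matrix.mul_nonsing_inv _ hB, Matrix.one_mulVec]⟩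

theorem isSymm_inv (hJ : J.PosDef) : J⁻¹.IsSymm := by
  have := hJ.inv.isHermitian
  rwa [Matrix.IsHermitian, Matrix.conjTranspose_eq_transpose_of_trivial] at this

theorem isHermitian_potentialHessian (hJ : J.PosDef) (α y : Fin M → ℝ) :
    (potentialHessian J α y).IsHermitian :=
  hJ.inv.isHermitian.sub (Matrix.isHermitian_diagonal _)

theorem posSemidef_potentialHessian (hJ : J.PosDef) {α y : Fin M → ℝ}
    (hy : y ∈ globalMinima (potential J α)) : (potentialHessian J α y).PosSemidef := by
  obtain ⟨B, hJB, hB⟩ := exists_factorisation hJ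
  obtain ⟨w, rfl⟩ := exists_preimage hB y
  refine Matrix.PosSemidef.of_dotProduct_mulVec_nonneg (isHermitian_potentialHessian hJ α _)
    fun v => ?_
  obtain ⟨g, rfl⟩ := exists_preimage hB v
  rw [star_trivial, ← freeHessian_rowVector hJB hB]
  exact freeHessian_nonneg ((mem_globalMinima_freeEnergy_iff hJB hB α w).2 hy) g

/-- The mean field equation for minimisers of the potential. -/
theorem mean_field_equation (hJ : J.PosDef) {α y : Fin M → ℝ}
    (hy : y ∈ globalMinima (potential J α)) :
    y = J.mulVec fun ν => α ν * Real.tanh (y ν) := by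
  obtain ⟨B, hJB, hB⟩ := exists_factorisation hJ
  obtain ⟨w, rfl⟩ := exists_preimage hB y
  ext l
  -- The derivative in the direction of the `l`-th row of `B` is the `l`-th coordinate of the
  -- equation.
  have h := freeGradient_eq_zero ((mem_globalMinima_freeEnergy_iff hJB hB α w).2 hy) (rowVector B l)
  rw [freeGradient, real_inner_comm, sub_eq_zero, inner_rowVector] at h
  rw [h]
  refine Finset.sum_congr rfl fun ν _ => ?_
  have : (inner ℝ (rowVector B ν) (rowVector B l) : ℝ) = J l ν := by
    rw [real_inner_comm, inner_rowVector_rowVector, hJB]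
  rw [this, inner_rowVector, mul_comm]

theorem inv_mulVec_eq (hJ : J.PosDef) {α y : Fin M → ℝ}
    (hy : y ∈ globalMinima (potential J α)) (l : Fin M) :
    J⁻¹.mulVec y l = α l * Real.tanh (y l) := by
  have hdet := (Matrix.isUnit_iff_isUnit_det _).1 hJ.isUnit
  have h := congrArg J⁻¹.mulVec (mean_field_equation hJ hy)
  rw [Matrix.mulVec_mulVec, Matrix.nonsing_inv_mul _ hdet, Matrix.one_mulVec] at h
  rw [h]

theorem potential_neg (J : Matrix (Fin M) (Fin M) ℝ) (α y : Fin M → ℝ) :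
    potential J α (-y) = potential J α y := by
  simp [potential, Matrix.mulVec_neg]

theorem neg_mem_globalMinima {α y : Fin M → ℝ} (hy : y ∈ globalMinima (potential J α)) :
    -y ∈ globalMinima (potential J α) := fun z => by rw [potential_neg]; exact hy z

theorem exists_globalMinima_potential (hJ : J.PosDef) (α : Fin M → ℝ) :
    (globalMinima (potential J α)).Nonempty := by
  obtain ⟨B, hJB, hB⟩ := exists_factorisation hJ
  obtain ⟨w, hw⟩ : (globalMinima (freeEnergy (rowVector B) α)).Nonempty := by
    refine (continuous_freeEnergy (rowVector B) α).exists_forall_le ?_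
    have h1 : Tendsto (fun r : ℝ => r * (r / 2 - ∑ ν, |α ν| * ‖rowVector B ν‖)) atTop atTop :=
      tendsto_id.atTop_mul_atTop₀ (tendsto_atTop_add_const_right _ _
        (tendsto_id.atTop_div_const two_pos))
    refine tendsto_atTop_mono (fun v => ?_)
      (h1.comp (tendsto_norm_cocompact_atTop (E := EuclideanSpace ℝ (Fin M))))
    refine le_trans (le_of_eq ?_) (freeEnergy_ge (rowVector B) α v)
    simp only [Function.comp]
    ring
  exact ⟨_, (mem_globalMinima_freeEnergy_iff hJB hB α w).1 hw⟩

end Minimisers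

/-! ### Fluctuations for heterogeneous coupling -/

section CentralLimit

variable {J : Matrix (Fin M) (Fin M) ℝ}

/-- The conditional central limit theorem for heterogeneous coupling at nondegenerate minimisers. -/
theorem heterogeneousFluctuations {N : ℕ → Fin M → ℕ} {α : Fin M → ℝ}
    (hN : ∀ ν, Tendsto (fun n => N n ν) atTop atTop)
    (hα : ∀ ν, Tendsto (fun n => (N n ν : ℝ) / (total (N n) : ℝ)) atTop (𝓝 (α ν)))
    (hrate : ∀ ν, Tendsto (fun n => Real.sqrt (total (N n) : ℝ) *
      ((N n ν : ℝ) / (total (N n) : ℝ) - α ν)) atTop (𝓝 0))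
    (hJ : J.PosDef) {x : Fin M → ℝ} (hx : ∀ l, 0 < x l)
    (hmin : globalMinima (potential J α) = {x, -x})
    (hS : (potentialHessian J α x).PosDef) : HeterogeneousFluctuations J α N x := by
  have hxm : x ∈ globalMinima (potential J α) := by rw [hmin]; simp
  set m : Fin M → ℝ := fun l => Real.tanh (x l) with hm
  set d : Fin M → ℝ := fun l => (1 - Real.tanh (x l) ^ 2)⁻¹ with hd
  set S := potentialHessian J α x with hSdef
  have hd0 : ∀ l, 0 < d l := fun l => inv_pos.2 (one_sub_tanh_sq_pos _)
  have hH : hessian (potentialTilde J α m) m = Matrix.diagonal d * S * Matrix.diagonal d :=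
    hessian_potentialTilde (isSymm_inv hJ) α m (inv_mulVec_eq hJ hxm)
  have hH' : hessian (potentialTilde J α m) (-m) = Matrix.diagonal d * S * Matrix.diagonal d := by
    have h := hessian_potentialTilde (isSymm_inv hJ) α m
      (inv_mulVec_eq hJ (neg_mem_globalMinima hxm))
    simp only [Pi.neg_apply, Real.tanh_neg, neg_sq, potentialHessian_neg] at h
    exact h
  have hDunit : IsUnit (Matrix.diagonal d) := by
    rw [Matrix.isUnit_iff_isUnit_det, Matrix.det_diagonal, isUnit_iff_ne_zero]
    exact Finset.prod_ne_zero_iff.2 fun l _ => (hd0 l).ne'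
  have hHpos : (Matrix.diagonal d * S * Matrix.diagonal d).PosDef := by
    have h := (Matrix.IsUnit.posDef_star_left_conjugate_iff hDunit).2 hS
    rwa [Matrix.star_eq_conjTranspose, Matrix.diagonal_conjTranspose, star_trivial] at h
  refine ⟨by rw [← hm, hH]; exact hHpos, by rw [← hm, hH, hH'], ?_⟩
  rw [← hm, hH]
  rcases isEmpty_or_nonempty (Fin M) with hM | hM
  · exact conditionalCLT_of_isEmpty _ _ _ _
  obtain ⟨B, hJB, hB⟩ := exists_factorisation hJ
  obtain ⟨w, hw⟩ := exists_preimage hB x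
  obtain ⟨R, hR⟩ := exists_eq_transpose_mul_self hS.posSemidef
  have hRdet : IsUnit R.det := by
    have h := (Matrix.isUnit_iff_isUnit_det _).1 hS.isUnit
    rw [hR, Matrix.det_mul] at h
    exact isUnit_of_mul_isUnit_right h
  have hRB : IsUnit (R * B).det := by rw [Matrix.det_mul]; exact hRdet.mul hB
  -- With `S = Rᵀ R` and `T = R B`, the norm `‖T g‖²` is the Hessian `S` evaluated at `B g`.
  let T : EuclideanSpace ℝ (Fin M) ≃L[ℝ] EuclideanSpace ℝ (Fin M) :=
    ContinuousLinearEquiv.equivOfInverse (Matrix.toEuclideanCLM (𝕜 := ℝ) (R * B))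
      (Matrix.toEuclideanCLM (𝕜 := ℝ) (R * B)⁻¹)
      (fun v => by
        rw [← mul_apply_eq_comp, ← map_mul, Matrix.nonsing_inv_mul _ hRB, map_one]
        rfl)
      (fun v => by
        rw [← mul_apply_eq_comp, ← map_mul, Matrix.mul_nonsing_inv _ hRB, map_one]
        rfl)
  have hTin : ∀ u g, (inner ℝ (T u) (T g) : ℝ) = B.mulVec u ⬝ᵥ S.mulVec (B.mulVec g) := by
    intro u g
    have h1 : ∀ v, (T v).ofLp = R.mulVec (B.mulVec v) := fun v => by
      rw [Matrix.mulVec_mulVec]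
      exact Matrix.ofLp_toEuclideanCLM _ _
    rw [EuclideanSpace.inner_eq_star_dotProduct, star_trivial, h1, h1, dotProduct_comm, hR,
      ← Matrix.mulVec_mulVec, Matrix.dotProduct_mulVec _ R.transpose, Matrix.vecMul_transpose]
  have hinw : ∀ ν, (inner ℝ (rowVector B ν) w : ℝ) = x ν := fun ν => by rw [inner_rowVector, hw]
  have hwmin : globalMinima (freeEnergy (rowVector B) α) = {w, -w} := by
    ext v
    rw [mem_globalMinima_freeEnergy_iff hJB hB, hmin, ← hw, ← Matrix.mulVec_neg]
    have hinj := Matrix.mulVec_injective_iff_isUnit.2 ((Matrix.isUnit_iff_isUnit_det _).2 hB)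
    simp only [Set.mem_insert_iff, Set.mem_singleton_iff, hinj.eq_iff]
    rw [← WithLp.ofLp_neg]
    exact or_congr (WithLp.ofLp_injective 2).eq_iff (WithLp.ofLp_injective 2).eq_iff
  have hSdet := (Matrix.isUnit_iff_isUnit_det _).1 hS.isUnit
  have hDinv : (Matrix.diagonal d)⁻¹ = Matrix.diagonal fun l => 1 - m l ^ 2 := by
    refine Matrix.inv_eq_right_inv ?_
    rw [Matrix.diagonal_mul_diagonal, ← Matrix.diagonal_one]
    congr 1
    ext l
    exact inv_mul_cancel₀ (one_sub_tanh_sq_pos (x l)).ne'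
  have main := conditionalCLT_of_freeEnergy (V := EuclideanSpace ℝ (Fin M)) (J := J) (T := T)
    (a := rowVector B) (w := w)
    -- `log cosh` is 1-Lipschitz, so each increment is at most `‖rowVector B ν‖ * ‖v - w‖`.
    (ε := fun n => ∑ ν, |Real.sqrt (total (N n)) * (proportion (N n) ν - α ν)| * ‖rowVector B ν‖)
    (E := covariance α m (Matrix.diagonal d * S * Matrix.diagonal d)⁻¹) hN hα
    (fun l k => by rw [inner_rowVector_rowVector, hJB])
    (fun ν => by rw [hinw]; exact hx ν) hwmin
    (fun g => by
      rw [freeHessian_rowVector hJB hB, hw, ← real_inner_self_eq_norm_sq, hTin])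
    (by
      rw [← Finset.sum_const_zero (s := (Finset.univ : Finset (Fin M)))]
      refine tendsto_finsetSum _ fun ν _ => ?_
      simpa [proportion] using (hrate ν).abs.mul_const ‖rowVector B ν‖)
    (fun n v => by
      rw [Finset.mul_sum, Finset.sum_mul]
      refine (Finset.abs_sum_le_sum_abs _ _).trans (Finset.sum_le_sum fun ν _ => ?_)
      rw [← mul_assoc, abs_mul, mul_assoc _ ‖rowVector B ν‖]
      refine mul_le_mul_of_nonneg_left ?_ (abs_nonneg _)
      have h := abs_log_cosh_sub_le (inner ℝ (rowVector B ν) w) (inner ℝ (rowVector B ν) (v - w))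
      rw [← inner_add_right, add_sub_cancel] at h
      exact h.trans (abs_real_inner_le_norm _ _))
    (posSemidef_covariance α (fun ν => (Real.tanh_sq_lt_one _).le) hHpos.inv.posSemidef)
    (fun t => by
      -- The shift of the means is the linear form `b ⬝ᵥ B g`. Representing it through `S` requires
      -- `B u = S⁻¹ b`, and then `‖T u‖² = b ⬝ᵥ S⁻¹ b`, which is the quadratic form of the inverse
      -- Hessian at `√α t`.
      set b : Fin M → ℝ := fun ν => (1 - m ν ^ 2) * (Real.sqrt (α ν) * t ν) with hb
      obtain ⟨u, hu⟩ := exists_preimage hB (S⁻¹.mulVec b)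
      have hSb : ∀ z, S⁻¹.mulVec b ⬝ᵥ S.mulVec z = b ⬝ᵥ z := by
        intro z
        have hsym : S.transpose = S := by
          have := hS.isHermitian
          rwa [Matrix.IsHermitian, Matrix.conjTranspose_eq_transpose_of_trivial] at this
        rw [Matrix.dotProduct_mulVec, ← Matrix.mulVec_transpose, hsym, Matrix.mulVec_mulVec,
          Matrix.mul_nonsing_inv _ hSdet, Matrix.one_mulVec]
      refine ⟨u, fun g => ?_, ?_⟩
      · rw [hTin, hu, hSb]
        refine Finset.sum_congr rfl fun ν _ => ?_
        rw [hinw, inner_rowVector]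
        simp only [hb, hm]
        ring
      · rw [dotProduct_covariance_mulVec, ← real_inner_self_eq_norm_sq, hTin, hu, hSb]
        congr 1
        · exact Finset.sum_congr rfl fun ν _ => by rw [hinw]
        · rw [Matrix.mul_inv_rev, Matrix.mul_inv_rev, hDinv, ← Matrix.mulVec_mulVec,
            ← Matrix.mulVec_mulVec]
          have e : (Matrix.diagonal fun l => 1 - m l ^ 2).mulVec
              (fun ν => Real.sqrt (α ν) * t ν) = b := by
            ext ν
            rw [Matrix.mulVec_diagonal]
          rw [e, Matrix.dotProduct_mulVec, ← Matrix.mulVec_transpose, Matrix.diagonal_transpose, e])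
  simpa only [hinw] using main

end CentralLimit

/-! ### Uniqueness and nondegeneracy for positive couplings -/

section PositiveCoupling

theorem sum_mul_lt_sum_mul {ι : Type*} [Fintype ι] {c p q : ι → ℝ} (hc : ∀ i, 0 ≤ c i)
    (hqp : ∀ i, q i < p i) (h0 : ∑ i, c i * p i ≠ 0) : ∑ i, c i * q i < ∑ i, c i * p i := by
  obtain ⟨i, -, hi⟩ := Finset.exists_ne_zero_of_sum_ne_zero h0
  have hci : 0 < c i := lt_of_le_of_ne (hc i) fun h => hi (by rw [← h, zero_mul])
  exact Finset.sum_lt_sum (fun j _ => mul_le_mul_of_nonneg_left (hqp j).le (hc j))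
    ⟨i, Finset.mem_univ i, mul_lt_mul_of_pos_left (hqp i) hci⟩

variable {J : Matrix (Fin M) (Fin M) ℝ} {α : Fin M → ℝ}

theorem mulVec_weighted_eq (J : Matrix (Fin M) (Fin M) ℝ) (α p : Fin M → ℝ) (l : Fin M) :
    J.mulVec (fun ν => α ν * p ν) l = ∑ ν, J l ν * α ν * p ν := by
  simp only [Matrix.mulVec, dotProduct, mul_assoc]

/-- Take a coordinate where `z / y` attains its maximum `c`. If `c > 1`, then `tanh z < c tanh y` in
every coordinate because `tanh s / s` decreases, and the two equations at the maximal coordinate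
give `z < c y` there, a contradiction. -/
theorem le_of_mean_field_equation (hpos : ∀ l k, 0 < J l k) (hα : ∀ ν, 0 ≤ α ν) {y z : Fin M → ℝ}
    (hy : ∀ l, 0 < y l) (hz : ∀ l, 0 < z l) (hy' : y = J.mulVec fun ν => α ν * Real.tanh (y ν))
    (hz' : z = J.mulVec fun ν => α ν * Real.tanh (z ν)) : z ≤ y := by
  rcases isEmpty_or_nonempty (Fin M) with hM | hM
  · exact fun l => isEmptyElim l
  obtain ⟨l, hl⟩ := Finite.exists_max fun l => z l / y l
  set c := z l / y l with hc
  have hzc : ∀ k, z k ≤ c * y k := fun k => (div_le_iff₀ (hy k)).1 (hl k)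
  by_contra hle
  have hc1 : 1 < c := by
    by_contra h
    refine hle fun k => (hzc k).trans ?_
    have := mul_le_mul_of_nonneg_right (not_lt.1 h) (hy k).le
    linarith
  have htanh : ∀ ν, Real.tanh (z ν) < c * Real.tanh (y ν) := by
    intro ν
    rcases lt_or_ge (y ν) (z ν) with h | h
    · have h1 := mul_tanh_lt_mul_tanh (hy ν) h
      have h2 := mul_le_mul_of_nonneg_right (hzc ν) (tanh_pos (hy ν)).le
      have h3 : y ν * Real.tanh (z ν) < y ν * (c * Real.tanh (y ν)) := by nlinarith
      exact lt_of_mul_lt_mul_left h3 (hy ν).le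
    · have h1 : Real.tanh (z ν) ≤ Real.tanh (y ν) := by
        rcases h.eq_or_lt with h | h
        · rw [h]
        · have h1 := mul_tanh_lt_mul_tanh (hz ν) h
          have h2 : Monotone Real.tanh := monotone_of_deriv_nonneg
            (fun s => (hasDerivAt_tanh s).differentiableAt)
            (fun s => by rw [(hasDerivAt_tanh s).deriv]; exact (one_sub_tanh_sq_pos s).le)
          exact h2 h.le
      have h2 := tanh_pos (hy ν)
      nlinarith
  have e1 := (congrFun hy' l).trans (mulVec_weighted_eq J α _ l)
  have e2 := (congrFun hz' l).trans (mulVec_weighted_eq J α _ l)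
  have e3 : ∑ ν, J l ν * α ν * (c * Real.tanh (y ν)) = c * y l := by
    rw [e1, Finset.mul_sum]
    exact Finset.sum_congr rfl fun ν _ => by ring
  have hne : c * y l ≠ 0 := (mul_pos (by linarith) (hy l)).ne'
  have h := sum_mul_lt_sum_mul (fun ν => mul_nonneg (hpos l ν).le (hα ν)) htanh (by rwa [e3])
  rw [e3, ← e2, hc, div_mul_cancel₀ _ (hy l).ne'] at h
  exact lt_irrefl _ h

/-- A null vector `v` solves the linearised mean field equation. Compare it with the equation of `x`
at a coordinate where `|v| / x` is maximal: since `x (1 - tanh² x) < tanh x`, the linearised map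
strictly decreases this ratio, which is impossible. -/
theorem posDef_potentialHessian (hJ : J.PosDef) (hpos : ∀ l k, 0 < J l k) (hα : ∀ ν, 0 ≤ α ν)
    {x : Fin M → ℝ} (hx : ∀ l, 0 < x l) (hxm : x ∈ globalMinima (potential J α)) :
    (potentialHessian J α x).PosDef := by
  have hS := posSemidef_potentialHessian hJ hxm
  rw [hS.posDef_iff_det_ne_zero]
  intro hdet
  obtain ⟨v, hv0, hv⟩ := Matrix.exists_mulVec_eq_zero_iff.2 hdet
  have hJdet := (Matrix.isUnit_iff_isUnit_det _).1 hJ.isUnit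
  rw [potentialHessian, Matrix.sub_mulVec, sub_eq_zero] at hv
  have hfix : v = J.mulVec fun ν => α ν * ((1 - Real.tanh (x ν) ^ 2) * v ν) := by
    have h := congrArg J.mulVec hv
    rw [Matrix.mulVec_mulVec, Matrix.mul_nonsing_inv _ hJdet, Matrix.one_mulVec] at h
    refine h.trans (congrArg J.mulVec ?_)
    ext ν
    rw [Matrix.mulVec_diagonal, mul_assoc]
  obtain ⟨l₀, hl₀⟩ := Function.ne_iff.1 hv0
  have : Nonempty (Fin M) := ⟨l₀⟩
  obtain ⟨l, hl⟩ := Finite.exists_max fun l => |v l| / x l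
  set c := |v l| / x l with hc
  have hvc : ∀ k, |v k| ≤ c * x k := fun k => (div_le_iff₀ (hx k)).1 (hl k)
  have hc0 : 0 < c := lt_of_lt_of_le (div_pos (abs_pos.2 hl₀) (hx l₀)) (hl l₀)
  have e1 := (congrFun (mean_field_equation hJ hxm) l).trans (mulVec_weighted_eq J α _ l)
  have e2 := (congrFun hfix l).trans (mulVec_weighted_eq J α _ l)
  have e3 : ∑ ν, J l ν * α ν * (c * Real.tanh (x ν)) = c * x l := by
    rw [e1, Finset.mul_sum]
    exact Finset.sum_congr rfl fun ν _ => by ring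
  have hw : ∀ ν, 0 ≤ J l ν * α ν := fun ν => mul_nonneg (hpos l ν).le (hα ν)
  have hlt : ∀ ν, (1 - Real.tanh (x ν) ^ 2) * |v ν| < c * Real.tanh (x ν) := by
    intro ν
    have h1 := mul_one_sub_tanh_sq_lt (hx ν)
    have h2 := mul_le_mul_of_nonneg_left (hvc ν) (one_sub_tanh_sq_pos (x ν)).le
    nlinarith
  have h := sum_mul_lt_sum_mul hw hlt (by rw [e3]; exact (mul_pos hc0 (hx l)).ne')
  rw [e3, hc, div_mul_cancel₀ _ (hx l).ne'] at h
  refine absurd h (not_lt.2 ?_)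
  conv_lhs => rw [e2]
  refine (Finset.abs_sum_le_sum_abs _ _).trans (Finset.sum_le_sum fun ν _ => ?_)
  rw [abs_mul (J l ν * α ν), abs_mul (1 - _), abs_of_nonneg (hw ν),
    abs_of_pos (one_sub_tanh_sq_pos _)]

end PositiveCoupling

/-! ### Two groups at low temperature -/

section TwoGroups

variable {J : Matrix (Fin 2) (Fin 2) ℝ} {α : Fin 2 → ℝ}

/-- For two groups the off-diagonal entry of `J⁻¹` is `-J 0 1 / det J`; all other terms are even in
each coordinate. With positive coupling, coordinates of opposite sign therefore cost energy. -/
theorem potential_abs (hJ : J.PosDef) (α y : Fin 2 → ℝ) :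
    potential J α |y| = potential J α y - J 0 1 / J.det * (|y 0 * y 1| - y 0 * y 1) := by
  have hsym : J 1 0 = J 0 1 := by
    have h := hJ.isHermitian.apply 0 1
    rwa [star_trivial] at h
  have hinv : J⁻¹ = J.det⁻¹ • !![J 1 1, -J 0 1; -J 1 0, J 0 0] := by
    rw [Matrix.inv_def, Ring.inverse_eq_inv', Matrix.adjugate_fin_two]
  simp only [potential, hinv, dotProduct, Matrix.mulVec, Fin.sum_univ_two, Matrix.smul_apply,
    smul_eq_mul, Pi.abs_apply, Real.cosh_abs, Matrix.of_apply, Matrix.cons_val_zero,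
    Matrix.cons_val_one, Matrix.cons_val', Matrix.cons_val_fin_one, hsym, abs_mul]
  have h0 := abs_mul_abs_self (y 0)
  have h1 := abs_mul_abs_self (y 1)
  linear_combination (1 / 2 * J.det⁻¹ * J 1 1) * h0 + (1 / 2 * J.det⁻¹ * J 0 0) * h1

/-- Two groups with positive couplings have exactly two minimisers at low temperature. -/
theorem exists_globalMinima_potential_eq (hJ : J.PosDef) (hpos : ∀ l k, 0 < J l k)
    (hα : ∀ ν, 0 ≤ α ν) (hlow : LowTemperature J α) :
    ∃ x : Fin 2 → ℝ, (∀ l, 0 < x l) ∧ globalMinima (potential J α) = {x, -x} := by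
  have hdet : 0 < J.det := hJ.det_pos
  -- At `0` the Hessian of the potential is `J⁻¹ - diag α`, which would be positive semidefinite at
  -- a minimiser.
  have hzero : (0 : Fin 2 → ℝ) ∉ globalMinima (potential J α) := by
    intro h
    refine hlow ?_
    have h1 := posSemidef_potentialHessian hJ h
    simpa [potentialHessian] using h1
  have habs : ∀ y ∈ globalMinima (potential J α), |y| ∈ globalMinima (potential J α) ∧
      0 ≤ y 0 * y 1 := by
    intro y hy
    have h1 := potential_abs hJ α y
    have h2 := hy |y|
    have hc : 0 < J 0 1 / J.det := div_pos (hpos 0 1) hdet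
    have h3 := le_abs_self (y 0 * y 1)
    have h4 : |y 0 * y 1| - y 0 * y 1 ≤ 0 := by
      by_contra h
      have := mul_pos hc (not_le.1 h)
      linarith
    have h5 : |y 0 * y 1| = y 0 * y 1 := by linarith
    refine ⟨fun z => ?_, h5 ▸ abs_nonneg _⟩
    rw [h1, h5, sub_self, mul_zero, sub_zero]
    exact hy z
  have hposabs : ∀ y ∈ globalMinima (potential J α), ∀ l, 0 < |y| l := by
    intro y hy l
    have he := mean_field_equation hJ (habs y hy).1
    have hl := (congrFun he l).trans (mulVec_weighted_eq J α _ l)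
    have hnn : ∀ ν, 0 ≤ Real.tanh (|y| ν) := by
      intro ν
      rcases (abs_nonneg (y ν)).eq_or_lt with h | h
      · rw [Pi.abs_apply, ← h, Real.tanh_zero]
      · exact (tanh_pos h).le
    have hterm : ∀ k ν, 0 ≤ J k ν * α ν * Real.tanh (|y| ν) := fun k ν =>
      mul_nonneg (mul_nonneg (hpos k ν).le (hα ν)) (hnn ν)
    -- If one coordinate vanishes, so does every nonnegative term of its mean field sum. As the
    -- couplings are positive, all `α ν * tanh (|y| ν)` are zero, and the equation forces `y = 0`.
    refine lt_of_le_of_ne (abs_nonneg _) fun h0 => ?_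
    have h0' : (0 : ℝ) = |y| l := h0
    rw [← h0'] at hl
    have hall := (Finset.sum_eq_zero_iff_of_nonneg fun ν _ => hterm l ν).1 hl.symm
    have hz : |y| = 0 := by
      rw [he]
      ext k
      rw [mulVec_weighted_eq]
      refine Finset.sum_eq_zero fun ν hν => ?_
      rcases mul_eq_zero.1 (hall ν hν) with h | h
      · rcases mul_eq_zero.1 h with h | h
        · exact absurd h (hpos l ν).ne'
        · rw [h, mul_zero, zero_mul]
      · rw [h, mul_zero]
    have hy0 : y = 0 := funext fun k => abs_eq_zero.1 (congrFun hz k)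
    exact hzero (hy0 ▸ hy)
  have hsign : ∀ y ∈ globalMinima (potential J α), y = |y| ∨ y = -|y| := by
    intro y hy
    have h0 : y 0 ≠ 0 := abs_pos.1 (hposabs y hy 0)
    have h1 : y 1 ≠ 0 := abs_pos.1 (hposabs y hy 1)
    have h2 := (habs y hy).2
    rcases h0.lt_or_gt with h | h
    · right
      have h3 : y 1 < 0 := lt_of_le_of_ne (by nlinarith) h1
      ext l
      fin_cases l <;> simp [abs_of_neg h, abs_of_neg h3]
    · left
      have h3 : 0 < y 1 := lt_of_le_of_ne (by nlinarith) h1.symm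
      ext l
      fin_cases l <;> simp [abs_of_pos h, abs_of_pos h3]
  obtain ⟨y, hy⟩ := exists_globalMinima_potential hJ α
  have hym := (habs y hy).1
  refine ⟨|y|, hposabs y hy, ?_⟩
  ext z
  constructor
  · intro hz
    have he : |z| = |y| := le_antisymm
      (le_of_mean_field_equation hpos hα (hposabs y hy) (hposabs z hz)
        (mean_field_equation hJ hym) (mean_field_equation hJ (habs z hz).1))
      (le_of_mean_field_equation hpos hα (hposabs z hz) (hposabs y hy)
        (mean_field_equation hJ (habs z hz).1) (mean_field_equation hJ hym))
    rw [← he]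
    exact hsign z hz
  · rintro (rfl | rfl)
    exacts [hym, neg_mem_globalMinima hym]

end TwoGroups

/-! ### Any number of groups, and the conclusion -/

/-- Minimality already gives semidefiniteness, and the determinant of the Hessian in `t` contains
that of the Hessian in `y` as a factor. -/
theorem posDef_potentialHessian_of_det_ne_zero {J : Matrix (Fin M) (Fin M) ℝ} (hJ : J.PosDef)
    {α x : Fin M → ℝ} (hxm : x ∈ globalMinima (potential J α))
    (hdet : (hessian (potentialTilde J α fun l => Real.tanh (x l))
      fun l => Real.tanh (x l)).det ≠ 0) : (potentialHessian J α x).PosDef := by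
  rw [(posSemidef_potentialHessian hJ hxm).posDef_iff_det_ne_zero]
  rw [hessian_potentialTilde (isSymm_inv hJ) α _ (inv_mulVec_eq hJ hxm), Matrix.det_mul,
    Matrix.det_mul] at hdet
  exact right_ne_zero_of_mul (left_ne_zero_of_mul hdet)

end CurieWeiss

end

theorem mainTheorem7 {M : ℕ} (N : ℕ → Fin M → ℕ) (α : Fin M → ℝ)
    (hN : ∀ ν, Tendsto (fun n => N n ν) atTop atTop)
    (hα : ∀ ν, Tendsto (fun n => (N n ν : ℝ) / (CurieWeiss.total (N n) : ℝ)) atTop (𝓝 (α ν))) :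
    -- homogeneous coupling
    (∀ β : ℝ, 1 < β →
      ∃ x : ℝ, 0 < x ∧
        CurieWeiss.globalMinima (CurieWeiss.homPotential β) = {x, -x} ∧
        IsGreatest {u : ℝ | Real.tanh (β * u) = u} (Real.tanh x) ∧
        CurieWeiss.HomogeneousFluctuations β α N x) ∧
    -- heterogeneous coupling
    ((∀ ν, Tendsto (fun n => Real.sqrt (CurieWeiss.total (N n) : ℝ) *
          ((N n ν : ℝ) / (CurieWeiss.total (N n) : ℝ) - α ν)) atTop (𝓝 0)) →
      ∀ J : Matrix (Fin M) (Fin M) ℝ, J.PosDef →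
        -- two groups
        (M = 2 → (∀ l k, 0 < J l k) → CurieWeiss.LowTemperature J α →
          ∃ x : Fin M → ℝ, (∀ l, 0 < x l) ∧
            CurieWeiss.globalMinima (CurieWeiss.potential J α) = {x, -x} ∧
            CurieWeiss.HeterogeneousFluctuations J α N x) ∧
        -- any number of groups
        (∀ x : Fin M → ℝ, (∀ l, 0 < x l) →
          CurieWeiss.globalMinima (CurieWeiss.potential J α) = {x, -x} →
          (CurieWeiss.hessian
            (CurieWeiss.potentialTilde J α fun l => Real.tanh (x l))
            (fun l => Real.tanh (x l))).det ≠ 0 →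
          CurieWeiss.HeterogeneousFluctuations J α N x)) := by

  refine ⟨fun β hβ => ?_, fun hrate J hJ => ⟨fun hM hpos hlow => ?_, fun x hx hmin hdet => ?_⟩⟩
  · obtain ⟨x, hx, hx', hmin⟩ := CurieWeiss.exists_globalMinima_homPotential_eq hβ
    exact ⟨x, hx, hmin, CurieWeiss.isGreatest_tanh hβ hx hx',
      CurieWeiss.homogeneousFluctuations hN hα hβ hx hx' hmin⟩
  · subst hM
    have hα0 := CurieWeiss.limit_proportion_nonneg hα
    obtain ⟨x, hx, hmin⟩ := CurieWeiss.exists_globalMinima_potential_eq hJ hpos hα0 hlow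
    exact ⟨x, hx, hmin, CurieWeiss.heterogeneousFluctuations hN hα hrate hJ hx hmin
      (CurieWeiss.posDef_potentialHessian hJ hpos hα0 hx (by rw [hmin]; simp))⟩
  · exact CurieWeiss.heterogeneousFluctuations hN hα hrate hJ hx hmin
      (CurieWeiss.posDef_potentialHessian_of_det_ne_zero hJ (by rw [hmin]; simp) hdet)
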